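/- Graphs are finite and may have loops; a graph is reflexive if every vertex is adjacent to itself. A reflexive graph $G$ is a strong cocomparability graph if the rows and columns of its adjacency matrix can be permuted simultaneously, by one ordering of the vertices, so that the resulting matrix does not contain $\begin{pmatrix}0&1\\1&0\end{pmatrix}$ as a submatrix (formed by any two rows and any two columns, not necessarily consecutive, each in increasing order). Strong cocomparability graphs can be recognized in polynomial time. That is, there are a deterministic multi-tape Turing machine with finite alphabets and a polynomial $p$ such that for every $n \ge 0$ and every graph $G$ with vertex set $\{0,\dots,n-1\}$ (loops allowed, reflexive or not), given as the bit string $w_G = 1^n\,0\,a_{0,0}a_{0,1}\cdots a_{n-1,n-1}$ that consists of $n$ in unary and the adjacency matrix $(a_{i,j})$ of $G$ row by row, the machine halts after at most $p(|w_G|)$ steps and outputs one bit, which is $1$ if $G$ is a strong cocomparability graph and $0$ otherwise. -/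

import Mathlib

/-- A graph on the vertex set `V` in which loops are allowed (but not multiple edges). -/
@[ext]
structure LoopGraph (V : Type*) where
  /-- the adjacency relation; `Adj v v` says that there is a loop at `v` -/
  Adj : V → V → Prop
  symm : ∀ u v, Adj u v → Adj v u

namespace LoopGraph

variable {V : Type*}

/-- A graph is reflexive if every vertex is adjacent to itself. -/
def IsReflexive (G : LoopGraph V) : Prop :=
  ∀ v, G.Adj v v

open Classical in
/-- The adjacency matrix, a symmetric `0,1`-matrix. -/
noncomputable def adjMatrix (G : LoopGraph V) : Matrix V V ℕ :=
  Matrix.of fun u v => if G.Adj u v then 1 else 0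

end LoopGraph

/-- `M` contains the Slash matrix (rows `01`, `10`) as a submatrix: two rows and two columns of
`M`, taken in increasing order, meet in the Slash matrix. -/
def ContainsSlash {n : ℕ} (M : Matrix (Fin n) (Fin n) ℕ) : Prop :=
  ∃ r c : Fin 2 → Fin n, StrictMono r ∧ StrictMono c ∧ M.submatrix r c = !![0, 1; 1, 0]

/-- A (finite) strong cocomparability graph: a reflexive graph whose adjacency matrix has a
symmetric ordering (the same vertex ordering `σ` for the rows and for the columns) that does not
contain the Slash matrix as a submatrix. -/
def LoopGraph.IsStrongCocomparability {V : Type*} (G : LoopGraph V) : Prop :=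
  G.IsReflexive ∧
    ∃ (n : ℕ) (σ : Fin n ≃ V), ¬ ContainsSlash (G.adjMatrix.submatrix σ σ)

/-- The inputs of the recognition problem: all finite graphs, loops allowed, with vertex set
`{0, …, n - 1}` for some `n`. -/
abbrev FiniteLoopGraph : Type :=
  Σ n : ℕ, LoopGraph (Fin n)

open Classical in
/-- The encoding of a graph as a bit string: the number `n` of vertices in unary, a terminating
`0`, and the `n ^ 2` entries of the adjacency matrix, row by row. -/
noncomputable def FiniteLoopGraph.encode (G : FiniteLoopGraph) : List Bool :=
  List.replicate G.1 true ++ false ::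
    (List.finRange G.1).flatMap fun i => (List.finRange G.1).map fun j => decide (G.2.Adj i j)

/-- The encoding determines the graph. -/
theorem FiniteLoopGraph.encode_injective : Function.Injective FiniteLoopGraph.encode := by
  have key : ∀ (m n : ℕ) (s t : List Bool),
      List.replicate m true ++ false :: s = List.replicate n true ++ false :: t →
        m = n ∧ s = t := by
    intro m
    induction m with
    | zero =>
      intro n s t h
      cases n with
      | zero => simpa using h
      | succ n => simp [List.replicate_succ] at h
    | succ m ih =>
      intro n s t h
      cases n with
      | zero => simp [List.replicate_succ] at h
      | succ n =>
        simp only [List.replicate_succ, List.cons_append, List.cons.injEq, true_and] at h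
        obtain ⟨h1, h2⟩ := ih n s t h
        exact ⟨by rw [h1], h2⟩
  have rows : ∀ (n : ℕ) (l : List (Fin n)) (f g : Fin n → List Bool),
      (∀ i, (f i).length = (g i).length) → l.flatMap f = l.flatMap g →
        ∀ i ∈ l, f i = g i := by
    intro n l f g hlen
    induction l with
    | nil => simp
    | cons a l ih =>
      intro h
      simp only [List.flatMap_cons] at h
      obtain ⟨h1, h2⟩ := List.append_inj h (hlen a)
      simp only [List.mem_cons, forall_eq_or_imp]
      exact ⟨h1, ih h2⟩
  rintro ⟨n, G⟩ ⟨m, H⟩ h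
  obtain ⟨hnm, h⟩ := key _ _ _ _ h
  dsimp only at hnm h
  subst hnm
  congr 1
  ext i j
  have hi := rows n _ _ _ (by simp) h i (List.mem_finRange i)
  rw [List.map_inj_left] at hi
  simpa using hi j (List.mem_finRange j)

open Classical in
/-- The property `P` of the objects of type `α`, given as bit strings by `enc`, is decidable in
polynomial time: some deterministic multi-tape (multi-stack) Turing machine outputs, for every
input `a`, whether `P a` holds, in a number of steps bounded by a polynomial in the length of
`enc a`. All alphabets of the machine are finite. -/
def DecidableInPolyTime {α : Type} (enc : α → List Bool) (P : α → Prop) : Prop :=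
  ∃ c : Turing.TM2ComputableInPolyTime enc Computability.encodeBool (fun a => decide (P a)),
    ∀ k, Finite (c.tm.Γ k)

/-!
For ordered pairs of vertices of a graph `G`, say that `(u, v)` forces `(x, y)` if the rows `u`, `v`
and the columns `x`, `y` of the adjacency matrix meet in the identity matrix. An ordering of the
vertices avoids the Slash matrix if and only if, whenever `u` precedes `v` and `(u, v)` forces
`(x, y)`, also `x` precedes `y`. Hence all pairs of a class of the equivalence relation generated by
forcing are ordered alike, and a pair of distinct vertices that is equivalent to its reversal is an
obstruction. It is the only one (`LoopGraph.isStrongCocomparability_iff`).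

For the converse, one of any two mutually inverse classes has to be chosen so that the resulting
relation is transitive. Vertices whose neighbourhoods are comparable are ordered by inclusion, and
twins in an arbitrary way; the choice concerns pairs with incomparable neighbourhoods, that is,
those which force something. A chain of forcing steps has a parity, as each step passes from rows to
columns or back. If `(a, b)`, `(b, c)`, `(c, a)` were all chosen, then the rows `a`, `b`, `c` would
meet suitable columns in an induced matching or in an induced hexagon
(`LoopGraph.IsFree.exists_third`). In either case the whole triangle moves along when one of its
pairs moves in its class (`LoopGraph.IsMatching.triangle`, `LoopGraph.IsHexagon.triangle`).

The balance of a class is the function on the vertices which counts in how many parities a vertex is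
the first member of a pair of the class, minus the same count for second members. As the triangle
moves along, the three balances sum up to zero (`LoopGraph.IsMatching.sum_balance`,
`LoopGraph.IsHexagon.sum_balance`). On the other hand, they do not all vanish
(`LoopGraph.IsMatching.balance_ne_zero`, `LoopGraph.IsHexagon.balance_ne_zero`). So, if the class
with the lexicographically positive balance is chosen whenever the balance is not zero, there is no
directed triangle (`LoopGraph.no_triangle`), however the remaining choices are made.

The criterion is checked by a search: for each pair, a polynomial number of relaxation rounds marks
its class, and it remains to see whether the reversal is reached. To run the search on a
multi-stack machine, structured programs over stacks are compiled to `Turing.TM2`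
(`StackProg.nonempty_computable`); arrays with random access and bounded loops are implemented by
such programs, and the operations on memories that are `StackProg.Feasible` are closed under
composition and under loops over the vertices. The recognition procedure is feasible by its shape
(`StackProg.feasible_recognize`), and its result is computed by an invariant for each loop
(`StackProg.recognize_spec`).
-/

/-! ### Forcing between ordered pairs, and triangles that move in their classes -/

namespace LoopGraph

variable {V : Type*} {G : LoopGraph V}

/-- `G.Forces (u, v) (x, y)`: among rows `u`, `v` and columns `x`, `y`, the edges are `u x` and
`v y`. The rows `u`, `v` and the columns `y`, `x` meet in the Slash matrix, so that a Slash-free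
ordering with `u` before `v` has `x` before `y`. -/
def Forces (G : LoopGraph V) (p q : V × V) : Prop :=
  G.Adj p.1 q.1 ∧ G.Adj p.2 q.2 ∧ ¬ G.Adj p.1 q.2 ∧ ¬ G.Adj p.2 q.1

theorem adj_comm {u v : V} : G.Adj u v ↔ G.Adj v u := ⟨G.symm u v, G.symm v u⟩

theorem Forces.symm {p q : V × V} (h : G.Forces p q) : G.Forces q p := by
  obtain ⟨h1, h2, h3, h4⟩ := h
  exact ⟨G.symm _ _ h1, G.symm _ _ h2, fun h => h4 (G.symm _ _ h), fun h => h3 (G.symm _ _ h)⟩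

theorem Forces.swap {p q : V × V} (h : G.Forces p q) : G.Forces p.swap q.swap :=
  ⟨h.2.1, h.1, h.2.2.2, h.2.2.1⟩

/-- `G.ForcesPar p q i`: some chain of `Forces`-steps leads from `p` to `q`, and the parity of its
length is `i` (`true` for odd). -/
inductive ForcesPar (G : LoopGraph V) (p : V × V) : V × V → Bool → Prop
  | refl : ForcesPar G p p false
  | step {q r : V × V} {i : Bool} : ForcesPar G p q i → G.Forces q r → ForcesPar G p r (!i)

namespace ForcesPar

variable {p q r : V × V} {i j : Bool}

theorem single (h : G.Forces p q) : G.ForcesPar p q true := step refl h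

theorem trans (h : G.ForcesPar p q i) (h' : G.ForcesPar q r j) : G.ForcesPar p r (xor i j) := by
  induction h' with
  | refl => simpa using h
  | step _ hf ih => simpa using ih.step hf

theorem symm (h : G.ForcesPar p q i) : G.ForcesPar q p i := by
  induction h with
  | refl => exact refl
  | step _ hf ih => simpa using (single hf.symm).trans ih

theorem swap (h : G.ForcesPar p q i) : G.ForcesPar p.swap q.swap i := by
  induction h with
  | refl => exact refl
  | step _ hf ih => exact ih.step hf.swap

theorem of_common (h : G.ForcesPar p q i) (h' : G.ForcesPar p r j) : G.ForcesPar q r (xor i j) :=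
  h.symm.trans h'

end ForcesPar

/-- Two ordered pairs are equivalent if a chain of `Forces`-steps joins them; they are then ordered
in the same way by every Slash-free ordering. -/
def ForcesEquiv (G : LoopGraph V) (p q : V × V) : Prop := ∃ i, G.ForcesPar p q i

namespace ForcesEquiv

variable {p q r : V × V}

theorem refl (p : V × V) : G.ForcesEquiv p p := ⟨_, .refl⟩

theorem symm (h : G.ForcesEquiv p q) : G.ForcesEquiv q p := h.imp fun _ h => h.symm

theorem trans (h : G.ForcesEquiv p q) (h' : G.ForcesEquiv q r) : G.ForcesEquiv p r :=
  let ⟨_, h⟩ := h; let ⟨_, h'⟩ := h'; ⟨_, h.trans h'⟩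

theorem swap (h : G.ForcesEquiv p q) : G.ForcesEquiv p.swap q.swap := h.imp fun _ h => h.swap

end ForcesEquiv

theorem Forces.equiv {p q : V × V} (h : G.Forces p q) : G.ForcesEquiv p q := ⟨_, .single h⟩

theorem ForcesPar.equiv {p q : V × V} {i : Bool} (h : G.ForcesPar p q i) : G.ForcesEquiv p q :=
  ⟨_, h⟩

/-- The pairs `(a, b)`, `(b, c)`, `(c, a)` may all be oriented as written: none of them is
equivalent to the reversal of another one. Nothing is required of a single pair and its own
reversal. -/
structure IsFree (G : LoopGraph V) (a b c : V) : Prop where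
  left : ¬ G.ForcesEquiv (a, b) (a, c)
  right : ¬ G.ForcesEquiv (a, b) (c, b)
  rest : ¬ G.ForcesEquiv (b, c) (a, c)

theorem IsFree.rotate {a b c : V} (h : G.IsFree a b c) : G.IsFree b c a :=
  ⟨fun h' => h.right h'.swap.symm, h.rest, fun h' => h.left h'.swap.symm⟩

/-- The rows `a`, `b`, `c` and the columns `a'`, `b'`, `c'` meet in the identity matrix. -/
structure IsMatching (G : LoopGraph V) (a b c a' b' c' : V) : Prop where
  aa : G.Adj a a'
  bb : G.Adj b b'
  cc : G.Adj c c'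
  ab : ¬ G.Adj a b'
  ac : ¬ G.Adj a c'
  ba : ¬ G.Adj b a'
  bc : ¬ G.Adj b c'
  ca : ¬ G.Adj c a'
  cb : ¬ G.Adj c b'

/-- Rows and columns induce a hexagon: only `a b'`, `b a'` and `c c'` are not adjacent. The columns
are named so that `(a, b)` forces `(a', b')`; the two other pairs then force `(c', a')` and
`(b', c')`, in this order. -/
structure IsHexagon (G : LoopGraph V) (a b c a' b' c' : V) : Prop where
  aa : G.Adj a a'
  ac : G.Adj a c'
  bb : G.Adj b b'
  bc : G.Adj b c'
  ca : G.Adj c a'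
  cb : G.Adj c b'
  ab : ¬ G.Adj a b'
  ba : ¬ G.Adj b a'
  cc : ¬ G.Adj c c'

section

variable {a b c a' b' c' p q x y : V}

theorem IsMatching.symm (h : G.IsMatching a b c a' b' c') : G.IsMatching a' b' c' a b c := by
  obtain ⟨h1, h2, h3, h4, h5, h6, h7, h8, h9⟩ := h
  constructor <;> rw [adj_comm] <;> assumption

theorem IsMatching.rotate (h : G.IsMatching a b c a' b' c') : G.IsMatching b c a b' c' a' := by
  obtain ⟨h1, h2, h3, h4, h5, h6, h7, h8, h9⟩ := h
  constructor <;> assumption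

theorem IsHexagon.symm (h : G.IsHexagon a b c a' b' c') : G.IsHexagon a' b' c' a b c := by
  obtain ⟨h1, h2, h3, h4, h5, h6, h7, h8, h9⟩ := h
  constructor <;> rw [adj_comm] <;> assumption

theorem IsHexagon.rotate (h : G.IsHexagon a b c a' b' c') : G.IsHexagon b c a c' a' b' := by
  obtain ⟨h1, h2, h3, h4, h5, h6, h7, h8, h9⟩ := h
  constructor <;> assumption

theorem IsMatching.forces (h : G.IsMatching a b c a' b' c') : G.Forces (a, b) (a', b') :=
  ⟨h.aa, h.bb, h.ab, h.ba⟩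

theorem IsHexagon.forces (h : G.IsHexagon a b c a' b' c') : G.Forces (a, b) (a', b') :=
  ⟨h.aa, h.bb, h.ab, h.ba⟩

/-- In a free triple, the third vertex is adjacent to both or to none of the two columns reached
from the pair `(a, b)`. -/
theorem IsFree.adj_iff (ht : G.IsFree a b c) (hf : G.Forces (a, b) (p, q)) :
    G.Adj c p ↔ G.Adj c q := by
  obtain ⟨h1, h2, h3, h4⟩ := hf
  dsimp only at h1 h2 h3 h4
  constructor
  · intro hp
    by_contra hq
    exact ht.right (Forces.equiv (q := (p, q)) ⟨h1, h2, h3, h4⟩ |>.trans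
      (Forces.equiv (p := (c, b)) ⟨hp, h2, hq, h4⟩).symm)
  · intro hq
    by_contra hp
    exact ht.left (Forces.equiv (q := (p, q)) ⟨h1, h2, h3, h4⟩ |>.trans
      (Forces.equiv (p := (a, c)) ⟨h1, hq, h3, hp⟩).symm)

/-- A `Forces`-step of one pair of a free triple moves the whole triple, unless the neighbourhood
of the third vertex is comparable with those of both other vertices. -/
theorem IsFree.exists_third (ht : G.IsFree a b c) (hf : G.Forces (a, b) (p, q))
    (h₁ : (∃ d, G.Adj a d ∧ ¬ G.Adj c d) ∨ ∃ d, G.Adj b d ∧ ¬ G.Adj c d)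
    (h₂ : (∃ d, G.Adj c d ∧ ¬ G.Adj a d) ∨ ∃ d, G.Adj c d ∧ ¬ G.Adj b d) :
    ∃ d, G.IsMatching a b c p q d ∨ G.IsHexagon a b c p q d := by
  have hiff := ht.adj_iff hf
  obtain ⟨hap, hbq, haq, hbp⟩ := hf
  dsimp only at hap hbq haq hbp
  by_cases hcp : G.Adj c p
  · have hcq := hiff.1 hcp
    have key : ∃ d, G.Adj a d ∧ G.Adj b d ∧ ¬ G.Adj c d := by
      rcases h₁ with ⟨d, hd, hcd⟩ | ⟨d, hd, hcd⟩
      · by_cases hbd : G.Adj b d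
        · exact ⟨d, hd, hbd, hcd⟩
        · exact absurd ((ht.adj_iff ⟨hd, hbq, haq, hbd⟩).2 hcq) hcd
      · by_cases had : G.Adj a d
        · exact ⟨d, had, hd, hcd⟩
        · exact absurd ((ht.adj_iff ⟨hap, hd, had, hbp⟩).1 hcp) hcd
    obtain ⟨d, h1, h2, h3⟩ := key
    exact ⟨d, .inr ⟨hap, h1, hbq, h2, hcp, hcq, haq, hbp, h3⟩⟩
  · have hcq := fun h => hcp (hiff.2 h)
    have key : ∃ d, ¬ G.Adj a d ∧ ¬ G.Adj b d ∧ G.Adj c d := by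
      rcases h₂ with ⟨d, hcd, hd⟩ | ⟨d, hcd, hd⟩
      · by_cases hbd : G.Adj b d
        · exact absurd ((ht.adj_iff ⟨hap, hbd, hd, hbp⟩).2 hcd) hcp
        · exact ⟨d, hd, hbd, hcd⟩
      · by_cases had : G.Adj a d
        · exact absurd ((ht.adj_iff ⟨had, hbq, haq, hd⟩).1 hcd) hcq
        · exact ⟨d, had, hd, hcd⟩
    obtain ⟨d, h1, h2, h3⟩ := key
    exact ⟨d, .inl ⟨hap, hbq, h3, haq, h1, hbp, h2, hcp, hcq⟩⟩

/-- In a matching, the columns of one pair may be replaced by any pair of columns which that pair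
forces, while the third column is kept. -/
theorem IsMatching.step (h : G.IsMatching a b c a' b' c') (ht : G.IsFree a b c)
    (hf : G.Forces (a, b) (p, q)) : G.IsMatching a b c p q c' := by
  have hiff := ht.adj_iff hf
  obtain ⟨hap, hbq, haq, hbp⟩ := hf
  have hcq : ¬ G.Adj c q := fun hcq =>
    h.ca ((ht.adj_iff ⟨h.aa, hbq, haq, h.ba⟩).2 hcq)
  exact ⟨hap, hbq, h.cc, haq, h.ac, hbp, h.bc, fun hcp => hcq (hiff.1 hcp), hcq⟩

/-- In a hexagon, the columns of one pair may be replaced by any pair of columns which that pair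
forces, while the third column is kept. -/
theorem IsHexagon.step (h : G.IsHexagon a b c a' b' c') (ht : G.IsFree a b c)
    (hf : G.Forces (a, b) (p, q)) : G.IsHexagon a b c p q c' := by
  have hiff := ht.adj_iff hf
  obtain ⟨hap, hbq, haq, hbp⟩ := hf
  have hcp : G.Adj c p := (ht.adj_iff (p := p) (q := b') ⟨hap, h.bb, h.ab, hbp⟩).2 h.cb
  exact ⟨hap, h.ac, hbq, h.bc, hcp, hiff.1 hcp, haq, hbp, h.cc⟩

theorem IsFree.of_equiv (ht : G.IsFree a b c) {u v w : V} (h1 : G.ForcesEquiv (a, b) (u, v))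
    (h2 : G.ForcesEquiv (b, c) (v, w)) (h3 : G.ForcesEquiv (c, a) (w, u)) : G.IsFree u v w :=
  ⟨fun h => ht.left ((h1.trans h).trans h3.swap.symm),
    fun h => ht.right ((h1.trans h).trans h2.swap.symm),
    fun h => ht.rest ((h2.trans h).trans h3.swap.symm)⟩

/-- For triples in hexagon position, the second and the third pair are exchanged. -/
theorem IsFree.of_equiv' (ht : G.IsFree a b c) {u v w : V} (h1 : G.ForcesEquiv (a, b) (u, v))
    (h2 : G.ForcesEquiv (b, c) (w, u)) (h3 : G.ForcesEquiv (c, a) (v, w)) : G.IsFree u v w :=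
  ⟨fun h => ht.right ((h1.trans h).trans h2.swap.symm),
    fun h => ht.left ((h1.trans h).trans h3.swap.symm),
    fun h => ht.rest ((h2.trans h.swap.symm).trans h3.swap.symm)⟩

/-- While `(a, b)` moves in its class, the third vertex of a matching triple alternates between
`c` and `c'`. -/
theorem IsMatching.triangle (h : G.IsMatching a b c a' b' c') (ht : G.IsFree a b c) {i : Bool}
    (hr : G.ForcesPar (a, b) (x, y) i) :
    ∃ x' y', G.IsMatching x y (bif i then c' else c) x' y' (bif i then c else c') ∧
      G.ForcesPar (b, c) (y, bif i then c' else c) i ∧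
      G.ForcesPar (c, a) (bif i then c' else c, x) i := by
  generalize hxy : (x, y) = s at hr
  induction hr generalizing x y with
  | refl =>
    obtain ⟨rfl, rfl⟩ := Prod.mk.inj hxy
    exact ⟨a', b', h, .refl, .refl⟩
  | @step q r i h1 hf ih =>
    subst hxy
    obtain ⟨u, v⟩ := q
    obtain ⟨x', y', hm, hb, hc⟩ := ih rfl
    have hfree := ht.of_equiv h1.equiv hb.equiv hc.equiv
    have hm' := hm.step hfree hf
    refine ⟨u, v, ?_, ?_, ?_⟩
    · cases i <;> exact hm'.symm
    · cases i <;> exact hb.step hm'.rotate.forces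
    · cases i <;> exact hc.step hm'.rotate.rotate.forces

/-- While `(a, b)` moves in its class, the third vertex of a hexagon triple alternates between
`c` and `c'`; at odd distance the other two pairs are exchanged. -/
theorem IsHexagon.triangle (h : G.IsHexagon a b c a' b' c') (ht : G.IsFree a b c) {i : Bool}
    (hr : G.ForcesPar (a, b) (x, y) i) :
    ∃ x' y', G.IsHexagon x y (bif i then c' else c) x' y' (bif i then c else c') ∧
      G.ForcesPar (b, c) (bif i then (c', x) else (y, c)) i ∧
      G.ForcesPar (c, a) (bif i then (y, c') else (c, x)) i := by
  generalize hxy : (x, y) = s at hr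
  induction hr generalizing x y with
  | refl =>
    obtain ⟨rfl, rfl⟩ := Prod.mk.inj hxy
    exact ⟨a', b', h, .refl, .refl⟩
  | @step q r i h1 hf ih =>
    subst hxy
    obtain ⟨u, v⟩ := q
    obtain ⟨x', y', hm, hb, hc⟩ := ih rfl
    cases i with
    | false =>
      have hm' := hm.step (ht.of_equiv h1.equiv hb.equiv hc.equiv) hf
      exact ⟨u, v, hm'.symm, hb.step hm'.rotate.forces, hc.step hm'.rotate.rotate.forces⟩
    | true =>
      have hm' := hm.step (ht.of_equiv' h1.equiv hb.equiv hc.equiv) hf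
      exact ⟨u, v, hm'.symm, hb.step hm'.rotate.rotate.forces, hc.step hm'.rotate.forces⟩

end

/-! ### The balance of a class -/

/-- `G.Tail p i v`: the vertex `v` is the first vertex of a pair that is joined to `p` by a chain
of parity `i`. -/
def Tail (G : LoopGraph V) (p : V × V) (i : Bool) (v : V) : Prop :=
  ∃ y, G.ForcesPar p (v, y) i

/-- The first vertices of the pairs that are joined to the reversal of `p` are the second vertices
of those that are joined to `p`. -/
theorem tail_swap {p : V × V} {i : Bool} {v : V} :
    G.Tail p.swap i v ↔ ∃ x, G.ForcesPar p (x, v) i :=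
  ⟨fun ⟨x, h⟩ => ⟨x, h.swap⟩, fun ⟨x, h⟩ => ⟨x, h.swap⟩⟩

open Classical in
/-- The number of parities with which `v` is the first vertex of a pair equivalent to `p`, minus
the number of parities with which it is the second one. Since a step changes both parities, this
depends only on the class of `p`. -/
noncomputable def balance (G : LoopGraph V) (p : V × V) (v : V) : ℤ :=
  (if G.Tail p false v then 1 else 0) + (if G.Tail p true v then 1 else 0) -
    ((if G.Tail p.swap false v then 1 else 0) + (if G.Tail p.swap true v then 1 else 0))

open Classical in
theorem balance_swap (p : V × V) : G.balance p.swap = - G.balance p := by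
  funext v
  simp [balance]

theorem Forces.tail_iff {p q : V × V} (h : G.Forces p q) (i : Bool) (v : V) :
    G.Tail p i v ↔ G.Tail q (!i) v := by
  constructor
  · rintro ⟨y, hy⟩
    exact ⟨y, by simpa using (ForcesPar.single h).of_common hy⟩
  · rintro ⟨y, hy⟩
    exact ⟨y, by simpa using (ForcesPar.single h).trans hy⟩

open Classical in
theorem Forces.balance_eq {p q : V × V} (h : G.Forces p q) : G.balance p = G.balance q := by
  funext v
  simp only [balance, h.tail_iff, h.swap.tail_iff, Bool.not_false, Bool.not_true]
  ring

theorem ForcesEquiv.balance_eq {p q : V × V} (h : G.ForcesEquiv p q) :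
    G.balance p = G.balance q := by
  obtain ⟨i, h⟩ := h
  induction h with
  | refl => rfl
  | step _ hf ih => exact ih.trans hf.balance_eq

section

variable {a b c a' b' c' : V}

/-- In a matching triangle, `(a, b)` and `(c, a)` share the images of `a`, for both parities. -/
theorem IsMatching.tail_iff (h : G.IsMatching a b c a' b' c') (ht : G.IsFree a b c) (i : Bool)
    (v : V) : G.Tail (a, b) i v ↔ G.Tail (c, a).swap i v := by
  rw [tail_swap]
  constructor
  · rintro ⟨y, hy⟩
    obtain ⟨_, _, _, _, h'⟩ := h.triangle ht hy
    exact ⟨_, h'⟩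
  · rintro ⟨x, hx⟩
    obtain ⟨_, _, _, h', _⟩ := h.rotate.rotate.triangle ht.rotate.rotate hx
    exact ⟨_, h'⟩

open Classical in
/-- The tails of each pair of the triangle are the heads of another one, so that everything
cancels. -/
theorem IsMatching.sum_balance (h : G.IsMatching a b c a' b' c') (ht : G.IsFree a b c) :
    G.balance (a, b) + G.balance (b, c) + G.balance (c, a) = 0 := by
  funext v
  simp only [balance, Pi.add_apply, Pi.zero_apply, h.tail_iff ht, h.rotate.tail_iff ht.rotate,
    h.rotate.rotate.tail_iff ht.rotate.rotate]
  ring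

/-- In a hexagon triangle, at even distance, `(a, b)` and `(c, a)` share the images of `a`. -/
theorem IsHexagon.tail_iff (h : G.IsHexagon a b c a' b' c') (ht : G.IsFree a b c) (v : V) :
    G.Tail (a, b) false v ↔ G.Tail (c, a).swap false v := by
  rw [tail_swap]
  constructor
  · rintro ⟨y, hy⟩
    obtain ⟨_, _, _, _, h'⟩ := h.triangle ht hy
    exact ⟨_, h'⟩
  · rintro ⟨x, hx⟩
    obtain ⟨_, _, _, h', _⟩ := h.rotate.rotate.triangle ht.rotate.rotate hx
    exact ⟨_, h'⟩

/-- In a hexagon triangle, at odd distance, the tails of `(a, b)` are the heads of `(b, c)`, since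
the other two pairs have been exchanged. -/
theorem IsHexagon.tail_iff' (h : G.IsHexagon a b c a' b' c') (ht : G.IsFree a b c) (v : V) :
    G.Tail (a, b) true v ↔ G.Tail (b, c).swap true v := by
  rw [tail_swap]
  constructor
  · rintro ⟨y, hy⟩
    obtain ⟨_, _, _, h', _⟩ := h.triangle ht hy
    exact ⟨_, h'⟩
  · rintro ⟨x, hx⟩
    obtain ⟨_, _, _, _, h'⟩ := h.rotate.triangle ht.rotate hx
    exact ⟨_, h'⟩

open Classical in
theorem IsHexagon.sum_balance (h : G.IsHexagon a b c a' b' c') (ht : G.IsFree a b c) :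
    G.balance (a, b) + G.balance (b, c) + G.balance (c, a) = 0 := by
  funext v
  simp only [balance, Pi.add_apply, Pi.zero_apply, h.tail_iff ht, h.rotate.tail_iff ht.rotate,
    h.rotate.rotate.tail_iff ht.rotate.rotate, h.tail_iff' ht, h.rotate.tail_iff' ht.rotate,
    h.rotate.rotate.tail_iff' ht.rotate.rotate]
  ring

/-- If a vertex is a tail of `p` for the even parity and not a head for the same parity, and `p` is
balanced, then it is a head for the odd parity. -/
theorem tail_swap_true_of_balance {p : V × V} {v : V} (h0 : G.balance p v = 0)
    (h1 : G.Tail p false v) (h2 : ¬ G.Tail p.swap false v) : G.Tail p.swap true v := by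
  by_contra h3
  simp only [balance, h1, h2, h3, if_true, if_false] at h0
  split_ifs at h0 <;> omega

/-- If the two pairs at `a` were balanced, then `a` would be the second vertex of a pair at odd
distance from `(a, b)` and the first vertex of one at odd distance from `(c, a)`. Moving the
triangle along both chains shows that `(a, b)` is equivalent to the reversal of `(c, a)`. -/
theorem IsMatching.balance_ne_zero (h : G.IsMatching a b c a' b' c') (ht : G.IsFree a b c)
    (h0 : G.balance (a, b) = 0) (h1 : G.balance (c, a) = 0) : False := by
  have hB : ¬ G.Tail (a, b).swap false a := by
    rw [tail_swap]
    rintro ⟨x, hx⟩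
    obtain ⟨_, _, _, h', _⟩ := h.triangle ht hx
    exact ht.rest h'.equiv
  have hC : ¬ G.Tail (c, a) false a := by
    rintro ⟨y, hy⟩
    obtain ⟨_, _, _, _, h'⟩ := h.rotate.rotate.triangle ht.rotate.rotate hy
    exact ht.right h'.swap.equiv.symm
  have hB' := tail_swap_true_of_balance (congrFun h0 a) ⟨b, .refl⟩ hB
  have hC' := tail_swap_true_of_balance (p := (a, c)) (v := a)
    (by rw [← Prod.swap_prod_mk, balance_swap, h1]; rfl) ⟨c, .refl⟩ hC
  obtain ⟨x, hx⟩ := tail_swap.1 hB'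
  obtain ⟨z, hz⟩ := hC'
  obtain ⟨_, _, _, hx', _⟩ := h.triangle ht hx
  obtain ⟨_, _, _, _, hz'⟩ := h.rotate.rotate.triangle ht.rotate.rotate hz
  obtain ⟨_, _, _, _, h2⟩ := h.rotate.triangle ht.rotate hx'
  obtain ⟨_, _, _, h3, _⟩ := h.rotate.triangle ht.rotate hz'
  exact ht.left (h2.equiv.trans h3.swap.equiv.symm)

/-- If `(a, b)` were balanced, then `(x, a)` and `(b, y)` would be at odd distance from it, for some
`x` and `y`. Moving the triangle to `(b, y)`, and then along the chain that joins the two images of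
`(c, a)`, turns `(a, b)` into its reversal. -/
theorem IsHexagon.balance_ne_zero (h : G.IsHexagon a b c a' b' c') (ht : G.IsFree a b c)
    (hab : ¬ G.ForcesEquiv (a, b) (b, a)) (h0 : G.balance (a, b) = 0) : False := by
  have ha : ¬ G.Tail (a, b).swap false a := by
    rw [tail_swap]
    rintro ⟨x, hx⟩
    obtain ⟨_, _, _, h', _⟩ := h.triangle ht hx
    exact ht.rest h'.equiv
  have hb : ¬ G.Tail (a, b) false b := by
    rintro ⟨y, hy⟩
    obtain ⟨_, _, _, _, h'⟩ := h.triangle ht hy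
    exact ht.rest h'.swap.equiv.symm
  obtain ⟨x, hx⟩ := tail_swap.1 (tail_swap_true_of_balance (congrFun h0 a) ⟨b, .refl⟩ ha)
  obtain ⟨y, hy⟩ := tail_swap_true_of_balance (p := (b, a)) (v := b)
    (by rw [← Prod.swap_prod_mk, balance_swap, h0]; rfl) ⟨a, .refl⟩ hb
  replace hy : G.ForcesPar (a, b) (b, y) true := hy
  obtain ⟨_, _, _, _, hx'⟩ := h.triangle ht hx
  obtain ⟨_, _, hm, hy', hy''⟩ := h.triangle ht hy
  have ht' : G.IsFree b y c' := ht.of_equiv' hy.equiv hy'.equiv hy''.equiv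
  obtain ⟨_, _, _, _, h'⟩ := hm.rotate.triangle ht'.rotate (hy''.of_common hx')
  exact hab (hy.equiv.trans h'.equiv)

end

end LoopGraph

/-! ### The ordering of the vertices -/

namespace LoopGraph

variable {V : Type*} {G : LoopGraph V}

/-- The neighbourhood of `u`; it contains `u` if there is a loop at `u`. -/
def nbrs (G : LoopGraph V) (u : V) : Set V := {w | G.Adj u w}

theorem Forces.not_subset {p q : V × V} (h : G.Forces p q) :
    ¬ G.nbrs p.1 ⊆ G.nbrs p.2 ∧ ¬ G.nbrs p.2 ⊆ G.nbrs p.1 :=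
  ⟨fun h' => h.2.2.2 (h' h.1), fun h' => h.2.2.1 (h' h.2.1)⟩

theorem exists_forces {p : V × V} (h₁ : ¬ G.nbrs p.1 ⊆ G.nbrs p.2)
    (h₂ : ¬ G.nbrs p.2 ⊆ G.nbrs p.1) : ∃ q, G.Forces p q := by
  obtain ⟨x, hx, hx'⟩ := Set.not_subset.1 h₁
  obtain ⟨y, hy, hy'⟩ := Set.not_subset.1 h₂
  exact ⟨(x, y), hx, hy, hy', hx'⟩

section Favored

variable [LinearOrder V]

/-- The choice of one of any two mutually inverse classes of pairs: the one whose balance is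
lexicographically positive, and an arbitrary one if the balance is zero. -/
def Favored (G : LoopGraph V) (p : V × V) : Prop :=
  0 < toLex (G.balance p) ∨ G.balance p = 0 ∧
    WellOrderingRel {q | G.ForcesEquiv p q} {q | G.ForcesEquiv p.swap q}

theorem ForcesEquiv.favored {p q : V × V} (h : G.ForcesEquiv p q) (hp : G.Favored p) :
    G.Favored q := by
  have key : ∀ {p q : V × V}, G.ForcesEquiv p q →
      {r | G.ForcesEquiv p r} = {r | G.ForcesEquiv q r} := fun h =>
    Set.ext fun r => ⟨fun h' => h.symm.trans h', fun h' => h.trans h'⟩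
  rwa [Favored, ← h.balance_eq, ← key h, ← key h.swap]

theorem Favored.balance_nonneg {p : V × V} (h : G.Favored p) : 0 ≤ toLex (G.balance p) := by
  rcases h with h | h
  · exact h.le
  · rw [h.1]; exact le_refl (0 : Lex (V → ℤ))

/-- The ordering of the vertices: a smaller neighbourhood comes first, vertices with the same
neighbourhood keep their given order, and the other pairs are ordered by the choice of classes. -/
def Precedes (G : LoopGraph V) (u v : V) : Prop :=
  G.nbrs u ⊂ G.nbrs v ∨ (G.nbrs u = G.nbrs v ∧ u < v) ∨
    (¬ G.nbrs u ⊆ G.nbrs v ∧ ¬ G.nbrs v ⊆ G.nbrs u ∧ G.Favored (u, v))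

theorem Forces.precedes_iff {p q : V × V} (h : G.Forces p q) :
    G.Precedes p.1 p.2 ↔ G.Favored p := by
  obtain ⟨h1, h2⟩ := h.not_subset
  refine ⟨fun h' => ?_, fun h' => .inr (.inr ⟨h1, h2, h'⟩)⟩
  rcases h' with h' | h' | h'
  · exact absurd h'.subset h1
  · exact absurd h'.1.subset h1
  · exact h'.2.2

theorem Favored.not_swap {p : V × V} (h : G.Favored p) : ¬ G.Favored p.swap := by
  have hneg : toLex (G.balance p.swap) = - toLex (G.balance p) := by rw [balance_swap]; rfl
  intro h'
  have h1 := h'.balance_nonneg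
  rw [hneg, Left.nonneg_neg_iff] at h1
  have h0 : G.balance p = 0 := le_antisymm (α := Lex (V → ℤ)) h1 h.balance_nonneg
  have h0' : G.balance p.swap = 0 := by rw [balance_swap, h0, neg_zero]
  rw [Favored, h0] at h
  rw [Favored, h0'] at h'
  have h2 := (h.resolve_left (lt_irrefl (0 : Lex (V → ℤ)))).2
  have h3 := (h'.resolve_left (lt_irrefl (0 : Lex (V → ℤ)))).2
  exact asymm_of WellOrderingRel h2 h3

theorem Forces.precedes {p q : V × V} (h : G.Forces p q) (hp : G.Precedes p.1 p.2) :
    G.Precedes q.1 q.2 :=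
  h.symm.precedes_iff.2 (h.equiv.favored (h.precedes_iff.1 hp))

theorem ForcesEquiv.precedes {p q : V × V} (h : G.ForcesEquiv p q) (hp : G.Precedes p.1 p.2) :
    G.Precedes q.1 q.2 := by
  obtain ⟨i, h⟩ := h
  induction h with
  | refl => exact hp
  | step _ hf ih => exact hf.precedes ih

theorem Precedes.asymm {u v : V} (h : G.Precedes u v) : ¬ G.Precedes v u := by
  rintro h'
  rcases h with h | h | h <;> rcases h' with h' | h' | h'
  · exact h.2 h'.subset
  · exact h.2 h'.1.subset
  · exact h'.2.1 h.subset
  · exact h'.2 h.1.subset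
  · exact lt_asymm h.2 h'.2
  · exact h'.2.1 h.1.subset
  · exact h.2.1 h'.subset
  · exact h.2.1 h'.1.subset
  · exact h.2.2.not_swap h'.2.2

/-- A directed triangle whose first pair is not comparable would have to move as a whole in its
classes; but then the balances of its pairs, all nonnegative, sum up to zero. -/
theorem no_triangle (hG : ∀ u v, u ≠ v → ¬ G.ForcesEquiv (u, v) (v, u)) {a b c : V} {p : V × V}
    (hf : G.Forces (a, b) p) (hab : G.Precedes a b) (hbc : G.Precedes b c)
    (hca : G.Precedes c a) : False := by
  have ht : G.IsFree a b c :=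
    ⟨fun h => hca.asymm (h.precedes hab), fun h => hbc.asymm (h.precedes hab),
      fun h => hca.asymm (h.precedes hbc)⟩
  obtain ⟨hn1, hn2⟩ := hf.not_subset
  dsimp only at hn1 hn2
  have hne : a ≠ b := by rintro rfl; exact hn1 subset_rfl
  have h₁ : (∃ d, G.Adj a d ∧ ¬ G.Adj c d) ∨ ∃ d, G.Adj b d ∧ ¬ G.Adj c d := by
    by_contra h
    push Not at h
    have hac : G.nbrs a ⊆ G.nbrs c := fun d => h.1 d
    have hbc : G.nbrs b ⊆ G.nbrs c := fun d => h.2 d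
    rcases hca with h | h | h
    · exact h.2 hac
    · exact hn2 (h.1 ▸ hbc)
    · exact h.2.1 hac
  have h₂ : (∃ d, G.Adj c d ∧ ¬ G.Adj a d) ∨ ∃ d, G.Adj c d ∧ ¬ G.Adj b d := by
    by_contra h
    push Not at h
    have hac : G.nbrs c ⊆ G.nbrs a := fun d => h.1 d
    have hcb : G.nbrs c ⊆ G.nbrs b := fun d => h.2 d
    rcases hbc with h | h | h
    · exact h.2 hcb
    · exact hn2 (h.1 ▸ hac)
    · exact h.2.1 hcb
  have key : ∀ x y z : Lex (V → ℤ), 0 ≤ x → 0 ≤ y → 0 ≤ z → x + y + z = 0 → x = 0 ∧ z = 0 := by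
    intro x y z hx hy hz h
    have hxy := add_nonneg hx hy
    have h1 := (add_eq_zero_iff_of_nonneg hxy hz).1 h
    exact ⟨((add_eq_zero_iff_of_nonneg hx hy).1 h1.1).1, h1.2⟩
  -- The matching case uses two balances; the hexagon case uses one, and the criterion for `(a, b)`.
  obtain ⟨d, h | h⟩ := ht.exists_third hf h₁ h₂
  · have := key _ _ _ (h.forces.precedes_iff.1 hab).balance_nonneg
      (h.rotate.forces.precedes_iff.1 hbc).balance_nonneg
      (h.rotate.rotate.forces.precedes_iff.1 hca).balance_nonneg (h.sum_balance ht)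
    exact h.balance_ne_zero ht this.1 this.2
  · have := key _ _ _ (h.forces.precedes_iff.1 hab).balance_nonneg
      (h.rotate.forces.precedes_iff.1 hbc).balance_nonneg
      (h.rotate.rotate.forces.precedes_iff.1 hca).balance_nonneg (h.sum_balance ht)
    exact h.balance_ne_zero ht (hG _ _ hne) this.1

variable [Fintype V]

theorem favored_or {p : V × V} (h : ¬ G.ForcesEquiv p p.swap) :
    G.Favored p ∨ G.Favored p.swap := by
  have hneg : toLex (G.balance p.swap) = - toLex (G.balance p) := by rw [balance_swap]; rfl
  simp only [Favored, hneg, Left.neg_pos_iff, Prod.swap_swap]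
  rcases lt_trichotomy (toLex (G.balance p)) 0 with h0 | h0 | h0
  · exact .inr (.inl h0)
  · have h0' : G.balance p = 0 := h0
    have hne : {q | G.ForcesEquiv p q} ≠ {q | G.ForcesEquiv p.swap q} := fun he =>
      h ((Set.ext_iff.1 he p.swap).2 (.refl _))
    rcases trichotomous_of WellOrderingRel {q | G.ForcesEquiv p q} {q | G.ForcesEquiv p.swap q}
      with h1 | h1 | h1
    · exact .inl (.inr ⟨h0', h1⟩)
    · exact absurd h1 hne
    · exact .inr (.inr ⟨by rw [balance_swap, h0', neg_zero], h1⟩)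
  · exact .inl (.inl h0)

theorem precedes_total (hG : ∀ u v, u ≠ v → ¬ G.ForcesEquiv (u, v) (v, u)) (u v : V) :
    G.Precedes u v ∨ u = v ∨ G.Precedes v u := by
  by_cases huv : u = v
  · exact .inr (.inl huv)
  by_cases h1 : G.nbrs u ⊆ G.nbrs v <;> by_cases h2 : G.nbrs v ⊆ G.nbrs u
  · rcases lt_or_gt_of_ne huv with h | h
    · exact .inl (.inr (.inl ⟨h1.antisymm h2, h⟩))
    · exact .inr (.inr (.inr (.inl ⟨h2.antisymm h1, h⟩)))
  · exact .inl (.inl ⟨h1, h2⟩)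
  · exact .inr (.inr (.inl ⟨h2, h1⟩))
  · rcases favored_or (p := (u, v)) (hG u v huv) with h | h
    · exact .inl (.inr (.inr ⟨h1, h2, h⟩))
    · exact .inr (.inr (.inr (.inr ⟨h2, h1, h⟩)))

theorem Precedes.trans (hG : ∀ u v, u ≠ v → ¬ G.ForcesEquiv (u, v) (v, u)) {a b c : V}
    (hab : G.Precedes a b) (hbc : G.Precedes b c) : G.Precedes a c := by
  rcases precedes_total hG a c with hac | rfl | hca
  · exact hac
  · exact absurd hbc hab.asymm
  -- In a directed triangle all pairs are comparable, so that all neighbourhoods agree, and the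
  -- triangle violates the given linear order.
  have key : ∀ {a b c : V}, G.Precedes a b → G.Precedes b c → G.Precedes c a →
      G.nbrs a ⊆ G.nbrs b := by
    intro a b c hab hbc hca
    rcases hab with h | h | h
    · exact h.subset
    · exact h.1.subset
    · obtain ⟨p, hf⟩ := exists_forces (p := (a, b)) h.1 h.2.1
      exact (no_triangle hG hf (.inr (.inr h)) hbc hca).elim
  have h1 := key hab hbc hca
  have h2 := key hbc hca hab
  have h3 := key hca hab hbc
  have hlt : ∀ {a b : V}, G.Precedes a b → G.nbrs b ⊆ G.nbrs a → a < b := by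
    intro a b h h'
    rcases h with h | h | h
    · exact absurd h' h.2
    · exact h.2
    · exact absurd h' h.2.1
  have l1 := hlt hab (h2.trans h3)
  have l2 := hlt hbc (h3.trans h1)
  have l3 := hlt hca (h1.trans h2)
  exact absurd (l1.trans (l2.trans l3)) (lt_irrefl a)

end Favored

/-- A Slash in a simultaneous rearrangement of the adjacency matrix is a `Forces`-step between
pairs that are arranged in opposite ways. -/
theorem containsSlash_iff {n : ℕ} (σ : Fin n ≃ V) :
    ContainsSlash (G.adjMatrix.submatrix σ σ) ↔
      ∃ i j k l : Fin n, i < j ∧ k < l ∧ G.Forces (σ i, σ j) (σ l, σ k) := by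
  constructor
  · rintro ⟨r, c, hr, hc, h⟩
    refine ⟨r 0, r 1, c 0, c 1, hr (by decide), hc (by decide), ?_⟩
    have h00 := congrFun (congrFun h 0) 0
    have h01 := congrFun (congrFun h 0) 1
    have h10 := congrFun (congrFun h 1) 0
    have h11 := congrFun (congrFun h 1) 1
    simp [adjMatrix] at h00 h01 h10 h11
    exact ⟨h01, h10, h00, h11⟩
  · rintro ⟨i, j, k, l, hij, hkl, h1, h2, h3, h4⟩
    dsimp only at h1 h2 h3 h4
    refine ⟨![i, j], ![k, l], ?_, ?_, ?_⟩
    · intro a b hab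
      fin_cases a <;> fin_cases b <;> simp_all
    · intro a b hab
      fin_cases a <;> fin_cases b <;> simp_all
    · ext a b
      fin_cases a <;> fin_cases b <;> simp [adjMatrix, h1, h2, h3, h4]

/-- The necessity of the criterion: a Slash-free ordering orders equivalent pairs alike. -/
theorem not_forcesEquiv_swap_of_not_containsSlash {n : ℕ} {σ : Fin n ≃ V}
    (h : ¬ ContainsSlash (G.adjMatrix.submatrix σ σ)) {u v : V} (huv : u ≠ v) :
    ¬ G.ForcesEquiv (u, v) (v, u) := by
  rw [containsSlash_iff] at h
  push Not at h
  have step : ∀ p q, G.Forces p q → σ.symm p.1 < σ.symm p.2 → σ.symm q.1 < σ.symm q.2 := by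
    intro p q hf hp
    by_contra hq
    have hne : q.1 ≠ q.2 := fun he => hf.2.2.1 (he ▸ hf.1)
    have hlt : σ.symm q.2 < σ.symm q.1 :=
      lt_of_le_of_ne (not_lt.1 hq) fun he => hne (σ.symm.injective he).symm
    exact h _ _ _ _ hp hlt (by simpa using hf)
  have equiv : ∀ p q, G.ForcesEquiv p q → σ.symm p.1 < σ.symm p.2 → σ.symm q.1 < σ.symm q.2 := by
    rintro p q ⟨i, hr⟩ hp
    induction hr with
    | refl => exact hp
    | step _ hf ih => exact step _ _ hf ih
  intro he
  rcases lt_or_gt_of_ne (fun h => huv (σ.symm.injective h) : σ.symm u ≠ σ.symm v) with hlt | hlt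
  · exact lt_asymm hlt (equiv _ _ he hlt)
  · exact lt_asymm hlt (equiv _ _ he.symm hlt)

theorem exists_equiv_fin_lt_iff [Fintype V] (r : V → V → Prop) [IsStrictTotalOrder V r] :
    ∃ σ : Fin (Fintype.card V) ≃ V, ∀ i j, i < j ↔ r (σ i) (σ j) := by
  classical
  let _ : LinearOrder V := linearOrderOfSTO r
  exact ⟨(monoEquivOfFin V rfl).toEquiv, fun i j => (monoEquivOfFin V rfl).lt_iff_lt.symm⟩

/-- A reflexive graph is a strong cocomparability graph if and only if no pair of distinct vertices
is equivalent to its reversal. -/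
theorem isStrongCocomparability_iff [Finite V] :
    G.IsStrongCocomparability ↔
      G.IsReflexive ∧ ∀ u v, u ≠ v → ¬ G.ForcesEquiv (u, v) (v, u) := by
  refine and_congr_right fun _ => ⟨?_, fun hG => ?_⟩
  · rintro ⟨n, σ, h⟩ u v huv
    exact not_forcesEquiv_swap_of_not_containsSlash h huv
  · cases nonempty_fintype V
    let _ : LinearOrder V := LinearOrder.lift' _ (Fintype.equivFin V).injective
    have : IsStrictTotalOrder V G.Precedes :=
      { trichotomous := fun u v h1 h2 => ((precedes_total hG u v).resolve_left h1).resolve_right h2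
        irrefl := fun u h => h.asymm h
        trans := fun _ _ _ => Precedes.trans hG }
    obtain ⟨σ, hσ⟩ := exists_equiv_fin_lt_iff G.Precedes
    refine ⟨_, σ, ?_⟩
    rw [containsSlash_iff]
    rintro ⟨i, j, k, l, hij, hkl, hf⟩
    exact (((hσ k l).1 hkl).asymm) (hf.precedes ((hσ i j).1 hij))

end LoopGraph

/-! ### Structured stack programs and their machines -/

/-- Structured programs over stacks of bits, indexed by `K`, and a finite control state in `σ`. -/
inductive StackProg (K σ : Type) : Type
  | push (k : K) (f : σ → Bool)
  | pop (k : K) (f : σ → Option Bool → σ)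
  | load (f : σ → σ)
  | seq (p q : StackProg K σ)
  | ite (c : σ → Bool) (p q : StackProg K σ)
  | loop (c : σ → Bool) (p : StackProg K σ)

namespace StackProg

open Turing

variable {K σ : Type}

/-- The labels of the machine code of a program: one for each elementary instruction and for each
test. -/
def Label : StackProg K σ → Type
  | push _ _ => Unit
  | pop _ _ => Unit
  | load _ => Unit
  | seq p q => Label p ⊕ Label q
  | ite _ p q => Option (Label p ⊕ Label q)
  | loop _ p => Option (Label p)

theorem finite_label : ∀ p : StackProg K σ, Finite p.Label
  | push _ _ => inferInstanceAs (Finite Unit)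
  | pop _ _ => inferInstanceAs (Finite Unit)
  | load _ => inferInstanceAs (Finite Unit)
  | seq p q =>
    have := finite_label p
    have := finite_label q
    inferInstanceAs (Finite (p.Label ⊕ q.Label))
  | ite _ p q =>
    have := finite_label p
    have := finite_label q
    inferInstanceAs (Finite (Option (p.Label ⊕ q.Label)))
  | loop _ p =>
    have := finite_label p
    inferInstanceAs (Finite (Option p.Label))

/-- The label at which the execution of a program begins. -/
def start : (p : StackProg K σ) → p.Label
  | push _ _ => ()
  | pop _ _ => ()
  | load _ => ()
  | seq p _ => Sum.inl p.start
  | ite _ _ _ => none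
  | loop _ _ => none

/-- The machine code of a program, inside a machine with labels `Λ`: the labels of the program are
embedded by `e`, and control passes to `x` at the end. -/
def code {Λ : Type} : (p : StackProg K σ) → (p.Label → Λ) → Λ → p.Label →
    TM2.Stmt (fun _ : K => Bool) Λ σ
  | push k f, _, x, _ => .push k f (.goto fun _ => x)
  | pop k f, _, x, _ => .pop k f (.goto fun _ => x)
  | load f, _, x, _ => .load f (.goto fun _ => x)
  | seq p q, e, x, l =>
    match l with
    | Sum.inl l => p.code (fun l => e (Sum.inl l)) (e (Sum.inr q.start)) l
    | Sum.inr l => q.code (fun l => e (Sum.inr l)) x l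
  | ite c p q, e, x, l =>
    match l with
    | none => .branch c (.goto fun _ => e (some (Sum.inl p.start)))
        (.goto fun _ => e (some (Sum.inr q.start)))
    | some (Sum.inl l) => p.code (fun l => e (some (Sum.inl l))) x l
    | some (Sum.inr l) => q.code (fun l => e (some (Sum.inr l))) x l
  | loop c p, e, x, l =>
    match l with
    | none => .branch c (.goto fun _ => e (some p.start)) (.goto fun _ => x)
    | some l => p.code (fun l => e (some l)) (e none) l

variable [DecidableEq K]

/-- Big-step semantics: `Exec p a b t` says that `p`, started with control state and stacks `a`,
ends with `b` after `t` steps. -/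
inductive Exec : StackProg K σ → σ × (K → List Bool) → σ × (K → List Bool) → ℕ → Prop
  | push {k f s S} : Exec (push k f) (s, S) (s, Function.update S k (f s :: S k)) 1
  | pop {k f s S} : Exec (pop k f) (s, S) (f s (S k).head?, Function.update S k (S k).tail) 1
  | load {f s S} : Exec (load f) (s, S) (f s, S) 1
  | seq {p q a b c t u} : Exec p a b t → Exec q b c u → Exec (seq p q) a c (t + u)
  | iteTrue {c p q a b t} : c a.1 = true → Exec p a b t → Exec (ite c p q) a b (1 + t)
  | iteFalse {c p q a b t} : c a.1 = false → Exec q a b t → Exec (ite c p q) a b (1 + t)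
  | loopEnd {c p a} : c a.1 = false → Exec (loop c p) a a 1
  | loopStep {c p a b d t u} : c a.1 = true → Exec p a b t → Exec (loop c p) b d u →
      Exec (loop c p) a d (1 + t + u)

/-- `Steps M n c d`: the machine `M` goes from `c` to `d` in exactly `n` steps. -/
def Steps {Λ : Type} (M : Λ → TM2.Stmt (fun _ : K => Bool) Λ σ) (n : ℕ)
    (c d : TM2.Cfg (fun _ : K => Bool) Λ σ) : Prop :=
  (flip bind (TM2.step M))^[n] (some c) = some d

theorem Steps.trans {Λ : Type} {M : Λ → TM2.Stmt (fun _ : K => Bool) Λ σ} {m n : ℕ}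
    {a b c : TM2.Cfg (fun _ : K => Bool) Λ σ} (h : Steps M m a b) (h' : Steps M n b c) :
    Steps M (m + n) a c := by
  unfold Steps at *
  rw [Nat.add_comm, Function.iterate_add_apply, h, h']

theorem Steps.one {Λ : Type} {M : Λ → TM2.Stmt (fun _ : K => Bool) Λ σ} {l : Λ} {s : σ}
    {S : K → List Bool} : Steps M 1 ⟨some l, s, S⟩ (TM2.stepAux (M l) s S) := rfl

/-- The machine code of `p`, placed inside any machine, does what the semantics of `p` says. -/
theorem Exec.steps {p : StackProg K σ} {a b : σ × (K → List Bool)} {t : ℕ} (h : Exec p a b t)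
    {Λ : Type} (M : Λ → TM2.Stmt (fun _ : K => Bool) Λ σ) (e : p.Label → Λ) (x : Λ)
    (hM : ∀ l, M (e l) = p.code e x l) :
    Steps M t ⟨some (e p.start), a.1, a.2⟩ ⟨some x, b.1, b.2⟩ := by
  induction h generalizing x with
  | push | pop | load =>
    refine Eq.trans (Steps.one (M := M)) ?_
    rw [hM]
    rfl
  | seq _ _ ih₁ ih₂ =>
    exact (ih₁ (fun l => e (Sum.inl l)) _ fun l => hM (Sum.inl l)).trans
      (ih₂ (fun l => e (Sum.inr l)) x fun l => hM (Sum.inr l))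
  | @iteTrue c p q a b t hc _ ih =>
    refine Steps.trans ?_ (ih (fun l => e (some (Sum.inl l))) x fun l => hM (some (Sum.inl l)))
    refine Eq.trans (Steps.one (M := M)) ?_
    erw [hM none]
    simp [code, hc]
  | @iteFalse c p q a b t hc _ ih =>
    refine Steps.trans ?_ (ih (fun l => e (some (Sum.inr l))) x fun l => hM (some (Sum.inr l)))
    refine Eq.trans (Steps.one (M := M)) ?_
    erw [hM none]
    simp [code, hc]
  | @loopEnd c p a hc =>
    refine Eq.trans (Steps.one (M := M)) ?_
    erw [hM none]
    simp [code, hc]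
  | @loopStep c p a b d t u hc _ _ ih₁ ih₂ =>
    refine Steps.trans (Steps.trans ?_ (ih₁ (fun l => e (some l)) (e none) fun l => hM (some l)))
      (ih₂ e x hM)
    refine Eq.trans (Steps.one (M := M)) ?_
    erw [hM none]
    simp [code, hc]

/-- The machine that runs the program `p` and halts: besides the labels of `p`, it has the label
`none`, at which it halts. -/
noncomputable def machine [Fintype K] [Fintype σ] (p : StackProg K σ) (k₀ k₁ : K) (s : σ) :
    FinTM2 :=
  have := finite_label p
  { K := K
    k₀ := k₀
    k₁ := k₁
    Γ := fun _ => Bool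
    Λ := Option p.Label
    ΛFin := Fintype.ofFinite _
    main := some p.start
    σ := σ
    initialState := s
    Γk₀Fin := inferInstanceAs (Fintype Bool)
    m := fun l =>
      match l with
      | none => .halt
      | some l => p.code some none l }

/-- A program that computes `f`, on input stack `k₀` and output stack `k₁`, in polynomial time is a
machine that does so. -/
theorem nonempty_computable [Fintype K] [Fintype σ] (p : StackProg K σ) (k₀ k₁ : K) (s : σ)
    {α : Type} (enc : α → List Bool) (f : α → Bool) (T : Polynomial ℕ)
    (h : ∀ a, ∃ t ≤ T.eval (enc a).length,
      Exec p (s, Function.update (fun _ => []) k₀ (enc a))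
        (s, Function.update (fun _ => []) k₁ [f a]) t) :
    ∃ c : TM2ComputableInPolyTime enc Computability.encodeBool f, ∀ k, Finite (c.tm.Γ k) := by
  refine ⟨{ tm := p.machine k₀ k₁ s
            inputAlphabet := Equiv.refl Bool
            outputAlphabet := Equiv.refl Bool
            time := T + 1
            outputsFun := fun a => ?_ }, fun k => (inferInstance : Finite Bool)⟩
  have h' := h a
  refine Classical.choice ?_
  obtain ⟨t, ht, he⟩ := h'
  have h1 := he.steps (p.machine k₀ k₁ s).m some none fun l => rfl
  have h2 := h1.trans (Steps.one (M := (p.machine k₀ k₁ s).m))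
  have hi : initList (p.machine k₀ k₁ s) (List.map (Equiv.refl Bool).invFun (enc a)) =
      ⟨some (some p.start), s, Function.update (fun _ => []) k₀ (enc a)⟩ := by
    unfold initList
    congr 1
    refine funext fun (k : K) => ?_
    by_cases hk : k₀ = k
    · subst hk
      erw [dif_pos rfl, Function.update_self]
      exact List.map_id _
    · erw [dif_neg (Ne.symm hk), Function.update_of_ne (Ne.symm hk)]
  have ho : haltList (p.machine k₀ k₁ s) (List.map (Equiv.refl Bool).invFun
      (Computability.encodeBool (f a))) =
      ⟨none, s, Function.update (fun _ => []) k₁ [f a]⟩ := by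
    unfold haltList
    congr 1
    refine funext fun (k : K) => ?_
    by_cases hk : k₁ = k
    · subst hk
      erw [dif_pos rfl, Function.update_self]
      rfl
    · erw [dif_neg (Ne.symm hk), Function.update_of_ne (Ne.symm hk)]
  refine ⟨⟨⟨t + 1, ?_⟩, ?_⟩⟩
  · rw [hi, Option.map_some, ho]
    exact h2
  · simpa using ht

end StackProg

/-! ### Running times and counting loops -/

namespace StackProg

variable {K σ F : Type} [DecidableEq K]

/-- `Runs p a b T`: the program `p` leads from `a` to `b` in at most `T` steps. -/
def Runs (p : StackProg K σ) (a b : σ × (K → List Bool)) (T : ℕ) : Prop :=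
  ∃ t ≤ T, Exec p a b t

theorem Runs.mono {p : StackProg K σ} {a b : σ × (K → List Bool)} {T T' : ℕ} (h : Runs p a b T)
    (hT : T ≤ T') : Runs p a b T' :=
  h.imp fun _ h => ⟨h.1.trans hT, h.2⟩

theorem Runs.congr {p : StackProg K σ} {a b b' : σ × (K → List Bool)} {T T' : ℕ}
    (h : Runs p a b T) (hT : T ≤ T') (hb : b = b') : Runs p a b' T' :=
  hb ▸ h.mono hT

theorem Exec.runs {p : StackProg K σ} {a b : σ × (K → List Bool)} {t : ℕ} (h : Exec p a b t) :
    Runs p a b t := ⟨t, le_rfl, h⟩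

theorem Runs.seq {p q : StackProg K σ} {a b c : σ × (K → List Bool)} {T U : ℕ} (h : Runs p a b T)
    (h' : Runs q b c U) : Runs (p.seq q) a c (T + U) :=
  let ⟨_, ht, h⟩ := h
  let ⟨_, hu, h'⟩ := h'
  ⟨_, Nat.add_le_add ht hu, h.seq h'⟩

theorem Runs.loopStep {p : StackProg K σ} {c : σ → Bool} {a b d : σ × (K → List Bool)} {T U : ℕ}
    (hc : c a.1 = true) (h : Runs p a b T) (h' : Runs (loop c p) b d U) :
    Runs (loop c p) a d (1 + T + U) :=
  let ⟨_, ht, h⟩ := h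
  let ⟨_, hu, h'⟩ := h'
  ⟨_, by omega, h.loopStep hc h'⟩

/-- Pop a symbol and remember it; at an empty stack, remember `none`. Here and below, the control
state is a pair of the remembered symbol, if any, and of flags. -/
def fetch (k : K) : StackProg K (Option Bool × F) := pop k fun s o => (o, s.2)

/-- Forget the remembered symbol. -/
def forget : StackProg K (Option Bool × F) := load fun s => (none, s.2)

/-- Push the remembered symbol. -/
def store (k : K) : StackProg K (Option Bool × F) := push k fun s => s.1.getD false

/-- Execute `p` as long as `fetch k` finds a symbol. -/
def whileFetch (k : K) (p : StackProg K (Option Bool × F)) : StackProg K (Option Bool × F) :=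
  (fetch k).seq (loop (fun s => s.1.isSome) (p.seq (fetch k)))

/-- Move the contents of `k` to `l`, in reverse order. -/
def moveAll (k l : K) : StackProg K (Option Bool × F) := whileFetch k (store l)

/-- Execute `p` once for each symbol on `k`, which is moved to `l` after that, and restore `k`. -/
def count (k l : K) (p : StackProg K (Option Bool × F)) : StackProg K (Option Bool × F) :=
  (whileFetch k (forget.seq (p.seq (push l fun _ => true)))).seq (moveAll l k)

theorem fetch_runs {k : K} {o : Option Bool} {r : F} {S : K → List Bool} :
    Runs (fetch k) ((o, r), S) (((S k).head?, r), Function.update S k (S k).tail) 1 :=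
  Exec.pop.runs

theorem moveAll_runs {k l : K} (hkl : k ≠ l) {o : Option Bool} {r : F} {S : K → List Bool} :
    Runs (moveAll k l) ((o, r), S)
      ((none, r), Function.update (Function.update S k []) l ((S k).reverse ++ S l))
      (3 * (S k).length + 2) := by
  have key : ∀ (L : List Bool) (S : K → List Bool), S k = L.tail →
      Runs (loop (fun s => s.1.isSome) ((store l).seq (fetch k))) ((L.head?, r), S)
        ((none, r), Function.update (Function.update S k []) l (L.reverse ++ S l))
        (3 * L.length + 1) := by
    intro L
    induction L with
    | nil =>
      intro S hS
      refine (Exec.loopEnd (a := ((none, r), S)) rfl).runs.congr (by omega) ?_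
      congr 1
      funext x
      by_cases h1 : x = k <;> by_cases h2 : x = l <;> simp_all
    | cons b L ih =>
      intro S hS
      have h1 : Runs ((store l).seq (fetch k)) ((some b, r), S)
          ((L.head?, r), Function.update (Function.update S l (b :: S l)) k L.tail) 2 := by
        have := (Exec.push (k := l) (f := fun s : Option Bool × F => s.1.getD false)
          (s := (some b, r)) (S := S)).runs.seq (fetch_runs (k := k))
        simpa [Function.update_of_ne hkl, hS, store] using this
      refine (Runs.loopStep rfl h1 (ih _ (by simp))).congr (by simp; omega) ?_
      congr 1
      funext x
      by_cases h1 : x = k <;> by_cases h2 : x = l <;> simp_all [Function.update_apply]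
  refine (fetch_runs.seq (key (S k) _ (by simp))).congr (by omega) ?_
  congr 1
  funext x
  by_cases h1 : x = k <;> by_cases h2 : x = l <;> simp_all [Function.update_apply]

/-- The execution of `count`: the configuration after `j` rounds is `R j`, except that during the
rounds `k` holds the rounds to come and `l` the past ones. -/
theorem count_runs {k l : K} (hkl : k ≠ l) {p : StackProg K (Option Bool × F)} {n T : ℕ}
    (R : ℕ → F × (K → List Bool)) (hk : ∀ j ≤ n, (R j).2 k = List.replicate n true)
    (hl : ∀ j ≤ n, (R j).2 l = [])
    (hp : ∀ j < n, Runs p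
      ((none, (R j).1), Function.update (Function.update (R j).2 k
        (List.replicate (n - 1 - j) true)) l (List.replicate j true))
      ((none, (R (j + 1)).1), Function.update (Function.update (R (j + 1)).2 k
        (List.replicate (n - 1 - j) true)) l (List.replicate j true)) T) :
    Runs (count k l p) ((none, (R 0).1), (R 0).2) ((none, (R n).1), (R n).2)
      (n * (T + 7) + 4) := by
  have key : ∀ d j, j + d = n →
      Runs (loop (fun s => s.1.isSome) ((forget.seq (p.seq (push l fun _ => true))).seq (fetch k)))
        (((List.replicate d true).head?, (R j).1), Function.update (Function.update (R j).2 k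
          (List.replicate (d - 1) true)) l (List.replicate j true))
        ((none, (R n).1), Function.update (Function.update (R n).2 k []) l
          (List.replicate n true)) (d * (T + 4) + 1) := by
    intro d
    induction d with
    | zero =>
      rintro j rfl
      exact (Exec.loopEnd rfl).runs.mono (by omega)
    | succ d ih =>
      intro j hj
      have h1 := hp j (by omega)
      rw [show n - 1 - j = d by omega] at h1
      have h2 : Runs ((forget.seq (p.seq (push l fun _ => true))).seq (fetch k))
          ((some true, (R j).1), Function.update (Function.update (R j).2 k
            (List.replicate d true)) l (List.replicate j true))
          (((List.replicate d true).head?, (R (j + 1)).1),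
            Function.update (Function.update (R (j + 1)).2 k
              (List.replicate (d - 1) true)) l (List.replicate (j + 1) true)) (T + 3) := by
        refine ((Exec.load.runs.seq (h1.seq Exec.push.runs)).seq fetch_runs).congr (by omega) ?_
        congr 1
        · simp [Function.update_of_ne hkl]
        · funext x
          by_cases h1 : x = k <;> by_cases h2 : x = l <;>
            simp_all [Function.update_apply, List.replicate_succ]
      exact (Runs.loopStep rfl h2 (ih (j + 1) (by omega))).mono (by rw [Nat.succ_mul]; omega)
  have h1 : Runs (fetch k) ((none, (R 0).1), (R 0).2) (((List.replicate n true).head?, (R 0).1),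
      Function.update (Function.update (R 0).2 k (List.replicate (n - 1) true)) l
        (List.replicate 0 true)) 1 := by
    refine fetch_runs.congr le_rfl ?_
    rw [hk 0 (by omega)]
    congr 1
    funext x
    have := hl 0 (by omega)
    by_cases h1 : x = k <;> by_cases h2 : x = l <;> simp_all
  refine ((h1.seq (key n 0 (by omega))).seq (moveAll_runs hkl.symm)).congr
    (by simp [Nat.mul_add]; omega) ?_
  congr 1
  funext x
  have h3 := hl n le_rfl
  have h4 := hk n le_rfl
  by_cases h1 : x = k <;> by_cases h2 : x = l <;> simp_all

end StackProg

/-! ### Arrays of bits -/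

/-- The two bit arrays of the recognition program: the adjacency matrix of the input graph, and the
marks of the pairs that have been reached. -/
inductive BitArray
  | adj
  | mark
  deriving DecidableEq

instance : Fintype BitArray := ⟨{.adj, .mark}, fun a => by cases a <;> simp⟩

/-- The stacks of the recognition machine. A loop variable `i` with value `x` is kept as `x` symbols
on `done i`, the remaining rounds being on `todo i`; an array is kept, row by row, on its stack
`back`, where the entries before the current position are moved to `front`; `size` holds the number
of vertices, `aux₁` and `aux₂` are used for counting, `out` receives the answer. -/
inductive Stack
  | todo (i : Fin 8)
  | done (i : Fin 8)
  | front (a : BitArray)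
  | back (a : BitArray)
  | size
  | aux₁
  | aux₂
  | out
  deriving DecidableEq, Fintype

/-- The entries of a square array, row by row: the entry `(x, y)` has position `x * n + y`. -/
def rowMajor {n : ℕ} (A : Fin n → Fin n → Bool) : List Bool :=
  List.ofFn fun p : Fin (n * n) => A p.divNat p.modNat

theorem rowMajor_eq_flatMap {n : ℕ} (A : Fin n → Fin n → Bool) :
    rowMajor A = (List.finRange n).flatMap fun i => (List.finRange n).map fun j => A i j := by
  rw [rowMajor, List.ofFn_mul, List.flatMap_def, List.ofFn_eq_map]
  congr 1
  refine List.map_congr_left fun i _ => ?_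
  rw [List.ofFn_eq_map]
  refine List.map_congr_left fun j _ => ?_
  congr 1
  · ext
    simp only [Fin.coe_divNat]
    rw [Nat.mul_comm, Nat.mul_add_div (Fin.pos i), Nat.div_eq_of_lt j.2, Nat.add_zero]
  · ext
    simp only [Fin.coe_modNat]
    rw [Nat.mul_comm, Nat.mul_add_mod, Nat.mod_eq_of_lt j.2]

@[simp]
theorem length_rowMajor {n : ℕ} (A : Fin n → Fin n → Bool) : (rowMajor A).length = n * n := by
  simp [rowMajor]

theorem position_lt {n : ℕ} (x y : Fin n) : (x : ℕ) * n + y < n * n :=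
  calc (x : ℕ) * n + y < x * n + n := by omega
    _ = (x + 1) * n := by ring
    _ ≤ n * n := Nat.mul_le_mul_right n x.2

theorem rowMajor_eq_append {n : ℕ} (A : Fin n → Fin n → Bool) (x y : Fin n) (b : Bool) :
    rowMajor (fun x' y' => if x' = x ∧ y' = y then b else A x' y') =
      (rowMajor A).take (x * n + y) ++ b :: (rowMajor A).drop (x * n + y + 1) := by
  have hp := position_lt x y
  have hset : rowMajor (fun x' y' => if x' = x ∧ y' = y then b else A x' y') =
      (rowMajor A).set (x * n + y) b := by
    refine List.ext_getElem (by simp) fun p h1 h2 => ?_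
    rw [List.getElem_set]
    simp only [rowMajor, List.getElem_ofFn]
    refine if_congr ?_ rfl rfl
    rw [Fin.ext_iff, Fin.ext_iff, Fin.coe_divNat, Fin.coe_modNat]
    constructor
    · rintro ⟨h3, h4⟩
      dsimp only at h3 h4
      rw [← h3, ← h4, Nat.mul_comm]
      exact Nat.div_add_mod p n
    · rintro rfl
      constructor
      · dsimp only
        rw [Nat.mul_comm, Nat.mul_add_div (Fin.pos x), Nat.div_eq_of_lt y.2, Nat.add_zero]
      · dsimp only
        rw [Nat.mul_comm, Nat.mul_add_mod, Nat.mod_eq_of_lt y.2]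
  rw [hset, List.set_eq_take_append_cons_drop, if_pos (by simpa using hp)]

theorem drop_rowMajor {n : ℕ} (A : Fin n → Fin n → Bool) (x y : Fin n) :
    (rowMajor A).drop (x * n + y) = A x y :: (rowMajor A).drop (x * n + y + 1) := by
  have h := rowMajor_eq_append A x y (A x y)
  have h' : (fun x' y' => if x' = x ∧ y' = y then A x y else A x' y') = A := by
    funext x' y'
    split_ifs with h
    · rw [h.1, h.2]
    · rfl
  rw [h'] at h
  have hp := position_lt x y
  nth_rewrite 1 [h]
  rw [List.drop_append_of_le_length (by simp [hp.le])]
  simp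

namespace StackProg

/-- Move one symbol of an array from `back` to `front`. -/
def advance {F : Type} (a : BitArray) : StackProg Stack (Option Bool × F) :=
  (fetch (.back a)).seq ((store (.front a)).seq forget)

/-- Move one row of an array from `back` to `front`. -/
def advanceRow {F : Type} (a : BitArray) : StackProg Stack (Option Bool × F) :=
  count .size .aux₂ (advance a)

/-- Move an array to the entry whose row and column are the loop variables `x` and `y`. -/
def seek {F : Type} (a : BitArray) (x y : Fin 8) : StackProg Stack (Option Bool × F) :=
  (count (.done x) .aux₁ (advanceRow a)).seq (count (.done y) .aux₁ (advance a))

/-- Combine the entry of an array at the loop variables `x` and `y` with the flags: the new flags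
are given by `g`, the new entry by `h`. -/
def access {F : Type} (a : BitArray) (x y : Fin 8) (g : F → Bool → F) (h : F → Bool → Bool) :
    StackProg Stack (Option Bool × F) :=
  (seek a x y).seq <| (fetch (.back a)).seq <|
    (push (.back a) fun s => h s.2 (s.1.getD false)).seq <|
    (load fun s => (none, g s.2 (s.1.getD false))).seq <| moveAll (.front a) (.back a)

/-- The stacks `S`, but with the array `a`, of contents `L`, at position `p`. -/
def atPos (S : Stack → List Bool) (a : BitArray) (L : List Bool) (p : ℕ) : Stack → List Bool :=
  Function.update (Function.update S (.front a) (L.take p).reverse) (.back a) (L.drop p)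

variable {F : Type} {r : F} {S : Stack → List Bool} {a : BitArray} {L : List Bool} {p n : ℕ}

theorem update_atPos {k : Stack} (h1 : k ≠ .front a) (h2 : k ≠ .back a) (l : List Bool) :
    Function.update (atPos S a L p) k l = atPos (Function.update S k l) a L p := by
  rw [atPos, atPos, Function.update_comm h2.symm, Function.update_comm h1.symm]

theorem advance_runs (hp : p < L.length) :
    Runs (advance a) ((none, r), atPos S a L p) ((none, r), atPos S a L (p + 1)) 3 := by
  refine (fetch_runs.seq (Exec.push.runs.seq Exec.load.runs)).congr (by omega) ?_
  rw [show atPos S a L p (.back a) = _ from (Function.update_self ..).trans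
    (List.drop_eq_getElem_cons hp)]
  congr 1
  funext k
  by_cases h1 : k = .front a
  · subst h1
    have h : (L.take (p + 1)).reverse = L[p] :: (L.take p).reverse := by
      rw [← List.take_append_getElem hp, List.reverse_append]
      rfl
    simp only [atPos, Function.update_self, h, ne_eq, reduceCtorEq, not_false_eq_true,
      Function.update_of_ne, List.head?_cons, Option.getD_some]
  · by_cases h2 : k = .back a
    · subst h2
      simp [atPos]
    · simp [atPos, h1, h2]

theorem advanceRow_runs (hs : S .size = List.replicate n true) (h₂ : S .aux₂ = [])
    (hp : p + n ≤ L.length) :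
    Runs (advanceRow a) ((none, r), atPos S a L p) ((none, r), atPos S a L (p + n))
      (n * 10 + 4) := by
  refine count_runs (by simp) (fun j => (r, atPos S a L (p + j))) (fun j _ => ?_)
    (fun j _ => ?_) fun j hj => ?_
  · simpa [atPos] using hs
  · simpa [atPos] using h₂
  · simp only [update_atPos (a := a) (k := .size) (by simp) (by simp),
      update_atPos (a := a) (k := .aux₂) (by simp) (by simp)]
    exact advance_runs (by omega)

theorem seek_runs {x y : Fin 8} {i j : ℕ} (hs : S .size = List.replicate n true)
    (h₁ : S .aux₁ = []) (h₂ : S .aux₂ = []) (hx : S (.done x) = List.replicate i true)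
    (hy : S (.done y) = List.replicate j true) (hij : i * n + j ≤ L.length) :
    Runs (seek a x y) ((none, r), atPos S a L 0) ((none, r), atPos S a L (i * n + j))
      (i * (n * 10 + 11) + j * 10 + 8) := by
  have hrow : Runs (count (.done x) .aux₁ (advanceRow a)) ((none, r), atPos S a L (0 * n))
      ((none, r), atPos S a L (i * n)) (i * (n * 10 + 4 + 7) + 4) := by
    refine count_runs (by simp) (fun u => (r, atPos S a L (u * n))) (fun u _ => ?_)
      (fun u _ => ?_) fun u hu => ?_
    · simpa [atPos] using hx
    · simpa [atPos] using h₁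
    · simp only [update_atPos (a := a) (k := .done x) (by simp) (by simp),
        update_atPos (a := a) (k := .aux₁) (by simp) (by simp), Nat.add_mul u, one_mul]
      refine advanceRow_runs (by simp [hs]) (by simp [h₂]) ?_
      have : (u + 1) * n ≤ i * n := Nat.mul_le_mul_right n hu
      rw [Nat.add_mul] at this
      omega
  have hcol : Runs (count (.done y) .aux₁ (advance a)) ((none, r), atPos S a L (i * n + 0))
      ((none, r), atPos S a L (i * n + j)) (j * (3 + 7) + 4) := by
    refine count_runs (by simp) (fun u => (r, atPos S a L (i * n + u))) (fun u _ => ?_)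
      (fun u _ => ?_) fun u hu => ?_
    · simpa [atPos] using hy
    · simpa [atPos] using h₁
    · simp only [update_atPos (a := a) (k := .done y) (by simp) (by simp),
        update_atPos (a := a) (k := .aux₁) (by simp) (by simp)]
      exact advance_runs (by omega)
  rw [zero_mul] at hrow
  exact (hrow.seq hcol).mono (by rw [Nat.add_assoc (n * 10)]; omega)

theorem access_runs {x y : Fin 8} {g : F → Bool → F} {h : F → Bool → Bool}
    {A : Fin n → Fin n → Bool} {i j : Fin n} (hs : S .size = List.replicate n true)
    (h₁ : S .aux₁ = []) (h₂ : S .aux₂ = []) (hx : S (.done x) = List.replicate i true)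
    (hy : S (.done y) = List.replicate j true) (hf : S (.front a) = [])
    (hb : S (.back a) = rowMajor A) :
    Runs (access a x y g h) ((none, r), S) ((none, g r (A i j)), Function.update S (.back a)
        (rowMajor fun i' j' => if i' = i ∧ j' = j then h r (A i j) else A i' j'))
      (13 * (n * n) + 21 * n + 13) := by
  have hS : S = atPos S a (rowMajor A) 0 := by
    funext k
    by_cases h1 : k = .front a
    · subst h1; simp [atPos, hf]
    · by_cases h2 : k = .back a
      · subst h2; simp [atPos, hb]
      · simp [atPos, h1, h2]
  have hp := position_lt i j
  have hseek := seek_runs (r := r) (a := a) (L := rowMajor A) hs h₁ h₂ hx hy (by simp [hp.le])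
  rw [← hS] at hseek
  have hlen : ((rowMajor A).take (i * n + j)).length ≤ n * n := by simp [hp.le]
  have hin : (i : ℕ) * (n * 10 + 11) ≤ 10 * (n * n) + 11 * n := by
    calc (i : ℕ) * (n * 10 + 11) ≤ n * (n * 10 + 11) := Nat.mul_le_mul_right _ i.2.le
      _ = _ := by ring
  refine (hseek.seq (fetch_runs.seq (Exec.push.runs.seq (Exec.load.runs.seq
    (moveAll_runs (by simp)))))).congr ?_ ?_
  · have hj := j.2
    simp only [atPos, Function.update_of_ne (show Stack.front a ≠ Stack.back a by simp),
      Function.update_self, List.length_reverse]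
    omega
  · rw [show atPos S a (rowMajor A) (i * n + j) (.back a) = _ from Function.update_self .. |>.trans
      (drop_rowMajor A i j)]
    congr 1
    funext k
    by_cases h1 : k = .front a
    · subst h1; simp [hf]
    · by_cases h2 : k = .back a
      · subst h2
        simp [atPos, rowMajor_eq_append]
      · simp [atPos, h1, h2]

end StackProg

/-! ### Feasible operations -/

namespace StackProg

/-- The data of the recognition program on graphs with `m + 1` vertices, so that the loop variables
always have a value: two flags, of which the
first one is an accumulator and the second one holds the answer, and the two arrays. -/
@[ext]
structure Memory (m : ℕ) where
  /-- the accumulator and the answer -/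
  flags : Bool × Bool
  /-- the contents of the arrays -/
  arr : BitArray → Fin (m + 1) → Fin (m + 1) → Bool

/-- The stacks inside `k` nested loops whose variables have the values `v`. -/
def contents {m : ℕ} (k : ℕ) (v : Fin 8 → Fin (m + 1))
    (arr : BitArray → Fin (m + 1) → Fin (m + 1) → Bool) : Stack → List Bool
  | .todo i => List.replicate (if (i : ℕ) < k then m - v i else m + 1) true
  | .done i => List.replicate (if (i : ℕ) < k then (v i : ℕ) else 0) true
  | .back a => rowMajor (arr a)
  | .size => List.replicate (m + 1) true
  | _ => []

/-- The control state and the stacks that represent a memory. -/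
def config {m : ℕ} (k : ℕ) (v : Fin 8 → Fin (m + 1)) (s : Memory m) :
    (Option Bool × Bool × Bool) × (Stack → List Bool) :=
  ((none, s.flags), contents k v s.arr)

/-- Operations on memories that may depend on the values of the loop variables. -/
abbrev Operation : Type := ∀ m : ℕ, (Fin 8 → Fin (m + 1)) → Memory m → Memory m

/-- Inside `k` nested loops, the operation `f` is carried out by a program in polynomial time. -/
def Feasible (k : ℕ) (f : Operation) : Prop :=
  ∃ (p : StackProg Stack (Option Bool × Bool × Bool)) (T : Polynomial ℕ),
    ∀ m v s, Runs p (config k v s) (config k v (f m v s)) (T.eval m)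

/-- Change the flags. -/
def setFlags (g : Bool × Bool → Bool × Bool) : Operation := fun _ _ s => ⟨g s.flags, s.arr⟩

/-- Combine an array entry with the flags; see `access`. -/
def visit (a : BitArray) (x y : Fin 8) (g : Bool × Bool → Bool → Bool × Bool)
    (h : Bool × Bool → Bool → Bool) : Operation := fun _ v s =>
  ⟨g s.flags (s.arr a (v x) (v y)), fun a' i j =>
    if a' = a ∧ i = v x ∧ j = v y then h s.flags (s.arr a (v x) (v y)) else s.arr a' i j⟩

/-- First `f`, then `g`. -/
def andThen (f g : Operation) : Operation := fun m v s => g m v (f m v s)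

/-- Carry out `f` for all values of the loop variable `k`, in increasing order. -/
def forAll (k : Fin 8) (f : Operation) : Operation := fun m v s =>
  (List.finRange (m + 1)).foldl (fun s i => f m (Function.update v k i) s) s

theorem Feasible.setFlags (k : ℕ) (g : Bool × Bool → Bool × Bool) : Feasible k (setFlags g) :=
  ⟨load fun s => (none, g s.2), 1, fun _ _ _ => by
    rw [Polynomial.eval_one]; exact Exec.load.runs⟩

theorem Feasible.andThen {k : ℕ} {f g : Operation} (hf : Feasible k f) (hg : Feasible k g) :
    Feasible k (andThen f g) := by
  obtain ⟨p, T, hp⟩ := hf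
  obtain ⟨q, U, hq⟩ := hg
  exact ⟨p.seq q, T + U, fun m v s => by
    rw [Polynomial.eval_add]; exact (hp m v s).seq (hq m v _)⟩

theorem Feasible.visit {k : ℕ} (a : BitArray) {x y : Fin 8} (hx : (x : ℕ) < k) (hy : (y : ℕ) < k)
    (g : Bool × Bool → Bool → Bool × Bool) (h : Bool × Bool → Bool → Bool) :
    Feasible k (visit a x y g h) := by
  refine ⟨access a x y g h, 13 * ((.X + 1) * (.X + 1)) + 21 * (.X + 1) + 13, fun m v s => ?_⟩
  refine (access_runs (A := s.arr a) (i := v x) (j := v y) rfl rfl rfl ?_ ?_ rfl rfl).congr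
    (by simp) ?_
  · simp [contents, hx]
  · simp [contents, hy]
  · unfold config
    congr 1
    funext l
    by_cases hl : l = .back a
    · subst hl
      simp [contents, StackProg.visit]
    · rw [Function.update_of_ne hl]
      cases l with
      | back b =>
        have hb : b ≠ a := fun hb => hl (hb ▸ rfl)
        simp [contents, StackProg.visit, hb]
      | _ => rfl

theorem update_contents {m : ℕ} {k : Fin 8} {v : Fin 8 → Fin (m + 1)}
    {arr : BitArray → Fin (m + 1) → Fin (m + 1) → Bool} (i : Fin (m + 1)) :
    Function.update (Function.update (contents k v arr) (.todo k) (List.replicate (m - i) true))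
      (.done k) (List.replicate i true) = contents (k + 1) (Function.update v k i) arr := by
  funext l
  cases l with
  | todo j =>
    rw [Function.update_of_ne (by simp)]
    by_cases hj : j = k
    · subst hj
      simp [contents]
    · have h1 : (j : ℕ) < k ↔ (j : ℕ) < k + 1 := by have := Fin.val_ne_of_ne hj; omega
      rw [Function.update_of_ne (by simp [hj])]
      simp only [contents, h1, Function.update_of_ne hj]
  | done j =>
    by_cases hj : j = k
    · subst hj
      simp [contents]
    · have h1 : (j : ℕ) < k ↔ (j : ℕ) < k + 1 := by have := Fin.val_ne_of_ne hj; omega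
      rw [Function.update_of_ne (by simp [hj]), Function.update_of_ne (by simp)]
      simp only [contents, h1, Function.update_of_ne hj]
  | _ => rfl

theorem Feasible.forAll {k : Fin 8} {f : Operation} (hf : Feasible (k + 1) f) :
    Feasible k (forAll k f) := by
  obtain ⟨p, T, hp⟩ := hf
  refine ⟨count (.todo k) (.done k) p, (.X + 1) * (T + 7) + 4, fun m v s => ?_⟩
  let R : ℕ → Memory m := fun j =>
    ((List.finRange (m + 1)).take j).foldl (fun s i => f m (Function.update v k i) s) s
  have hR : R (m + 1) = StackProg.forAll k f m v s := by
    simp only [R, StackProg.forAll]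
    rw [List.take_of_length_le (by simp)]
  have h := count_runs (k := .todo k) (l := .done k) (by simp) (p := p) (n := m + 1)
    (T := T.eval m) (fun j => ((R j).flags, contents k v (R j).arr))
    (fun j _ => by simp [contents]) (fun j _ => by simp [contents]) fun j hj => by
      have h1 := hp m (Function.update v k ⟨j, hj⟩) (R j)
      have h2 : R (j + 1) = f m (Function.update v k ⟨j, hj⟩) (R j) := by
        simp only [R]
        rw [List.take_add_one, List.getElem?_eq_getElem (by simpa using hj)]
        simp
      unfold config at h1
      rw [← h2, ← update_contents, ← update_contents] at h1
      exact h1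
  refine h.congr (by simp) ?_
  dsimp only
  rw [hR]
  rfl

end StackProg

/-! ### The search, and its correctness -/

namespace LoopGraph

variable {V : Type*}

/-- The pairs that are reached from `p` by at most `j` `Forces`-steps. -/
def reachedIn (G : LoopGraph V) (p : V × V) : ℕ → Set (V × V)
  | 0 => {p}
  | j + 1 => reachedIn G p j ∪ {q | ∃ r ∈ reachedIn G p j, G.Forces r q}

theorem reachedIn_mono (G : LoopGraph V) (p : V × V) : Monotone (G.reachedIn p) :=
  monotone_nat_of_le_succ fun _ => Set.subset_union_left

/-- The sets `reachedIn` grow strictly until they are stationary, hence the number of all pairs is a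
sufficient number of rounds. -/
theorem forcesEquiv_subset_reachedIn [Fintype V] (G : LoopGraph V) (p : V × V) :
    {q | G.ForcesEquiv p q} ⊆ G.reachedIn p (Fintype.card (V × V)) := by
  have grow : ∀ j, (∃ i ≤ j, G.reachedIn p (i + 1) = G.reachedIn p i) ∨
      j + 1 ≤ (G.reachedIn p j).ncard := by
    intro j
    induction j with
    | zero => exact .inr (by simp [reachedIn])
    | succ j ih =>
      rcases ih with ⟨i, hi, h⟩ | h
      · exact .inl ⟨i, by omega, h⟩
      · by_cases he : G.reachedIn p (j + 1) = G.reachedIn p j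
        · exact .inl ⟨j, by omega, he⟩
        · have hss : G.reachedIn p j ⊂ G.reachedIn p (j + 1) :=
            (reachedIn_mono G p (Nat.le_succ j)).ssubset_of_ne (Ne.symm he)
          have := Set.ncard_lt_ncard hss (Set.toFinite _)
          exact .inr (by omega)
  obtain ⟨i, hi, h⟩ : ∃ i ≤ Fintype.card (V × V), G.reachedIn p (i + 1) = G.reachedIn p i := by
    refine (grow _).resolve_right fun h => ?_
    have := Set.ncard_le_encard (G.reachedIn p (Fintype.card (V × V)))
    have h2 : (G.reachedIn p (Fintype.card (V × V))).ncard ≤ Nat.card (V × V) :=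
      Set.ncard_le_card _
    rw [Nat.card_eq_fintype_card] at h2
    omega
  rintro q ⟨b, hq⟩
  refine reachedIn_mono G p hi ?_
  induction hq with
  | refl => exact reachedIn_mono G p (Nat.zero_le i) rfl
  | step _ hf ih => exact h ▸ Or.inr ⟨_, ih, hf⟩

end LoopGraph

namespace StackProg

open Classical in
/-- The memory that holds the graph `G`, the set `B` of marked pairs and the answer `ok`, while the
accumulator is `acc`. -/
noncomputable def memory' {m : ℕ} (G : LoopGraph (Fin (m + 1)))
    (B : Set (Fin (m + 1) × Fin (m + 1))) (acc ok : Prop) : Memory m :=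
  ⟨(decide acc, decide ok), fun
    | .adj => fun i j => decide (G.Adj i j)
    | .mark => fun i j => decide ((i, j) ∈ B)⟩

/-- The memory between two operations, where the accumulator is true. -/
noncomputable abbrev memory {m : ℕ} (G : LoopGraph (Fin (m + 1)))
    (B : Set (Fin (m + 1) × Fin (m + 1))) (ok : Prop) : Memory m :=
  memory' G B True ok

/-- Make the accumulator false unless an array entry has the value `b`. -/
def test (a : BitArray) (x y : Fin 8) (b : Bool) : Operation :=
  visit a x y (fun r c => (r.1 && (c == b), r.2)) (fun _ c => c)

/-- Make the accumulator false unless the pair `(x, y)` forces `(x', y')`. -/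
def testForces (x y x' y' : Fin 8) : Operation :=
  andThen (andThen (test .adj x x' true) (test .adj y y' true))
    (andThen (test .adj x y' false) (test .adj y x' false))

/-- Mark `(x', y')` if it is forced by the marked pair `(x, y)`; these are the variables `4` to `7`.
-/
def relax : Operation :=
  andThen (andThen (test .mark 4 5 true) (testForces 4 5 6 7))
    (visit .mark 6 7 (fun r _ => (true, r.2)) (fun r c => c || r.1))

/-- Reject if `(x, y)` is marked and forces the reversal of the pair from which the search began;
these are the variables `2`, `3` and `0`, `1`. -/
def check : Operation :=
  andThen (andThen (test .mark 2 3 true) (testForces 2 3 1 0))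
    (setFlags fun r => (true, r.2 && !r.1))

/-- Relax all steps, once; since marks set on the way are used at once, more pairs may be marked
than those forced by a pair that was marked before. -/
def pass : Operation := forAll 4 (forAll 5 (forAll 6 (forAll 7 relax)))

/-- Mark the class of the pair of the variables `0` and `1`, and reject if it contains the reversal
of this pair. -/
def search : Operation :=
  andThen
    (andThen (forAll 2 (forAll 3 (visit .mark 2 3 (fun r _ => r) fun _ _ => false)))
      (visit .mark 0 1 (fun r _ => r) fun _ _ => true))
    (andThen (forAll 2 (forAll 3 pass)) (forAll 2 (forAll 3 check)))

/-- The recognition of strong cocomparability graphs. -/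
def recognize : Operation :=
  andThen (forAll 0 (visit .adj 0 0 (fun r c => (r.1, r.2 && c)) fun _ c => c))
    (forAll 0 (forAll 1 search))

theorem feasible_test {k : ℕ} (a : BitArray) {x y : Fin 8} (b : Bool) (hx : (x : ℕ) < k)
    (hy : (y : ℕ) < k) : Feasible k (test a x y b) := .visit a hx hy _ _

theorem feasible_testForces {k : ℕ} {x y x' y' : Fin 8} (hx : (x : ℕ) < k) (hy : (y : ℕ) < k)
    (hx' : (x' : ℕ) < k) (hy' : (y' : ℕ) < k) : Feasible k (testForces x y x' y') :=
  .andThen (.andThen (feasible_test _ _ hx hx') (feasible_test _ _ hy hy'))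
    (.andThen (feasible_test _ _ hx hy') (feasible_test _ _ hy hx'))

theorem feasible_recognize : Feasible 0 recognize := by
  have hrelax : Feasible ((7 : Fin 8) + 1) relax :=
    .andThen (.andThen (feasible_test _ _ (by decide) (by decide))
      (feasible_testForces (by decide) (by decide) (by decide) (by decide)))
      (.visit _ (by decide) (by decide) _ _)
  have hpass : Feasible ((3 : Fin 8) + 1) pass :=
    .forAll (k := 4) (.forAll (k := 5) (.forAll (k := 6) (.forAll (k := 7) hrelax)))
  have hcheck : Feasible ((3 : Fin 8) + 1) check :=
    .andThen (.andThen (feasible_test _ _ (by decide) (by decide))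
      (feasible_testForces (by decide) (by decide) (by decide) (by decide))) (.setFlags _ _)
  have hsearch : Feasible ((1 : Fin 8) + 1) search :=
    .andThen (.andThen (.forAll (k := 2) (.forAll (k := 3) (.visit _ (by decide) (by decide) _ _)))
      (.visit _ (by decide) (by decide) _ _))
      (.andThen (.forAll (k := 2) (.forAll (k := 3) hpass))
        (.forAll (k := 2) (.forAll (k := 3) hcheck)))
  exact .andThen (.forAll (k := 0) (.visit _ (by decide) (by decide) _ _))
    (.forAll (k := 0) (.forAll (k := 1) hsearch))

section Correctness

variable {m : ℕ} {G : LoopGraph (Fin (m + 1))} {B : Set (Fin (m + 1) × Fin (m + 1))}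
  {acc ok : Prop} {v : Fin 8 → Fin (m + 1)}

theorem test_adj (x y : Fin 8) :
    test .adj x y true m v (memory' G B acc ok) =
      memory' G B (acc ∧ G.Adj (v x) (v y)) ok := by
  ext a <;> simp [test, visit, memory'] <;> grind

theorem test_not_adj (x y : Fin 8) :
    test .adj x y false m v (memory' G B acc ok) =
      memory' G B (acc ∧ ¬ G.Adj (v x) (v y)) ok := by
  ext a <;> simp [test, visit, memory'] <;> grind

theorem test_mark (x y : Fin 8) :
    test .mark x y true m v (memory' G B acc ok) =
      memory' G B (acc ∧ (v x, v y) ∈ B) ok := by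
  ext a <;> simp [test, visit, memory'] <;> grind

theorem testForces_eq (x y x' y' : Fin 8) :
    testForces x y x' y' m v (memory' G B acc ok) =
      memory' G B (acc ∧ G.Forces (v x, v y) (v x', v y')) ok := by
  simp only [testForces, andThen, test_adj, test_not_adj, LoopGraph.Forces]
  congr 1
  simp only [and_assoc]

theorem relax_eq : relax m v (memory G B ok) =
    memory G (B ∪ {q | q = (v 6, v 7) ∧ (v 4, v 5) ∈ B ∧ G.Forces (v 4, v 5) q}) ok := by
  simp only [relax, andThen, memory, test_mark, testForces_eq]
  refine Memory.ext (by simp [visit, memory']) ?_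
  funext a i j
  cases a with
  | adj => simp [visit, memory']
  | mark =>
    by_cases h : i = v 6 ∧ j = v 7
    · rw [Bool.eq_iff_iff]
      simp [visit, memory', h]
    · simp only [not_and] at h
      simp [visit, memory']
      grind

theorem check_eq {rej : Prop} : check m v (memory G B (¬ rej)) =
    memory G B (¬ (rej ∨ (v 2, v 3) ∈ B ∧ G.Forces (v 2, v 3) (v 1, v 0))) := by
  simp only [check, andThen, memory, test_mark, testForces_eq]
  refine Memory.ext (Prod.ext (by simp [setFlags, memory']) ?_) rfl
  rw [Bool.eq_iff_iff]
  simp [setFlags, memory']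

theorem loop_eq {rej : Prop} :
    visit .adj 0 0 (fun r c => (r.1, r.2 && c)) (fun _ c => c) m v (memory G B (¬ rej)) =
      memory G B (¬ (rej ∨ ¬ G.Adj (v 0) (v 0))) := by
  refine Memory.ext (Prod.ext rfl ?_) ?_
  · rw [Bool.eq_iff_iff]
    simp [visit, memory']
  · funext a i j
    cases a <;> simp [visit, memory']
    grind

theorem clear_eq :
    visit .mark 2 3 (fun r _ => r) (fun _ _ => false) m v (memory G B ok) =
      memory G (B \ {(v 2, v 3)}) ok := by
  refine Memory.ext (by simp [visit, memory']) ?_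
  funext a i j
  cases a <;> simp [visit, memory']
  grind

theorem mark_eq :
    visit .mark 0 1 (fun r _ => r) (fun _ _ => true) m v (memory G B ok) =
      memory G (B ∪ {(v 0, v 1)}) ok := by
  refine Memory.ext (by simp [visit, memory']) ?_
  funext a i j
  cases a <;> simp [visit, memory']
  grind

/-- If each round of a loop leads from stage `j` to stage `j + c`, then so does the loop, with
`m + 1` times as many stages. -/
theorem forAll_stage {k : Fin 8} {f : Operation} {P : ℕ → Memory m → Prop} {c : ℕ}
    (hf : ∀ i j s, P j s → P (j + c) (f m (Function.update v k i) s)) {j : ℕ} {s : Memory m}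
    (hs : P j s) : P (j + (m + 1) * c) (forAll k f m v s) := by
  have key : ∀ (l : List (Fin (m + 1))) j s, P j s →
      P (j + l.length * c) (l.foldl (fun s i => f m (Function.update v k i) s) s) := by
    intro l
    induction l with
    | nil => intro j s hs; simpa using hs
    | cons i l ih =>
      intro j s hs
      have := ih _ _ (hf i j s hs)
      rwa [add_assoc, add_comm c, ← Nat.succ_mul] at this
  simpa [forAll] using key (List.finRange (m + 1)) j s hs

/-- If the round of index `i` of a loop adds `Y i` to what has been achieved, then the loop adds
all the `Y i`. -/
theorem forAll_iSup {α : Type} [CompleteLattice α] {k : Fin 8} {f : Operation}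
    {R : α → Memory m → Prop} {Y : Fin (m + 1) → α}
    (hf : ∀ i a s, R a s → R (a ⊔ Y i) (f m (Function.update v k i) s)) {a : α} {s : Memory m}
    (hs : R a s) : R (a ⊔ ⨆ i, Y i) (forAll k f m v s) := by
  have key : ∀ (l : List (Fin (m + 1))) a s, R a s →
      R (a ⊔ ⨆ i ∈ l, Y i) (l.foldl (fun s i => f m (Function.update v k i) s) s) := by
    intro l
    induction l with
    | nil => intro a s hs; simpa using hs
    | cons i l ih =>
      intro a s hs
      have := ih _ _ (hf i a s hs)
      have he : ⨆ j ∈ i :: l, Y j = Y i ⊔ ⨆ j ∈ l, Y j := by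
        simp [iSup_or, iSup_sup_eq]
      rwa [sup_assoc, ← he] at this
  simpa [forAll] using key (List.finRange (m + 1)) a s hs

theorem clearAll_eq : forAll 2 (forAll 3 (visit .mark 2 3 (fun r _ => r) fun _ _ => false)) m v
    (memory G B ok) = memory G ∅ ok := by
  let R : Set (Fin (m + 1) × Fin (m + 1)) → Memory m → Prop := fun a s =>
    ∃ B, s = memory G B ok ∧ Disjoint B a
  have h : R (∅ ⊔ ⨆ x, ⨆ y, {(x, y)}) (forAll 2
      (forAll 3 (visit .mark 2 3 (fun r _ => r) fun _ _ => false)) m v (memory G B ok)) := by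
    refine forAll_iSup (fun x a s hs => forAll_iSup (fun y a s hs => ?_) hs)
      ⟨B, rfl, Set.disjoint_empty B⟩
    obtain ⟨B, rfl, hB⟩ := hs
    refine ⟨_, clear_eq, ?_⟩
    have h2 : Function.update (Function.update v 2 x) 3 y 2 = x := by simp
    rw [h2, Function.update_self]
    exact Disjoint.sup_right (hB.mono_left Set.sdiff_subset) Set.disjoint_sdiff_left
  obtain ⟨B', h, hB'⟩ := h
  have : B' = ∅ := by
    refine Set.eq_empty_of_forall_notMem fun p hp => ?_
    refine Set.disjoint_left.1 hB' hp (.inr ?_)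
    simp only [Set.iSup_eq_iUnion, Set.mem_iUnion]
    exact ⟨p.1, p.2, rfl⟩
  rw [h, this]

/-- A pass keeps the marks inside any set that is closed under `Forces`, and marks all pairs that
are forced by a marked pair. -/
theorem pass_spec {U : Set (Fin (m + 1) × Fin (m + 1))}
    (hU : ∀ p ∈ U, ∀ q, G.Forces p q → q ∈ U) (hB : B ⊆ U) :
    ∃ B', pass m v (memory G B ok) = memory G B' ok ∧ B' ⊆ U ∧
      B ∪ {q | ∃ p ∈ B, G.Forces p q} ⊆ B' := by
  let R : Set (Fin (m + 1) × Fin (m + 1)) → Memory m → Prop := fun a s =>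
    ∃ B', s = memory G B' ok ∧ B' ⊆ U ∧ B ∪ a ⊆ B'
  have h : R (∅ ⊔ ⨆ x, ⨆ y, ⨆ x', ⨆ y', {q | q = (x', y') ∧ (x, y) ∈ B ∧ G.Forces (x, y) q})
      (pass m v (memory G B ok)) := by
    refine forAll_iSup (fun x a s hs => forAll_iSup (fun y a s hs => forAll_iSup
      (fun x' a s hs => forAll_iSup (fun y' a s hs => ?_) hs) hs) hs) ⟨B, rfl, hB, by simp⟩
    obtain ⟨B', rfl, hU', hB'⟩ := hs
    refine ⟨_, relax_eq, ?_⟩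
    simp only [Function.update_self, Function.update_of_ne, ne_eq, Fin.reduceEq,
      not_false_eq_true]
    constructor
    · rintro q (hq | ⟨rfl, hq, hf⟩)
      · exact hU' hq
      · exact hU _ (hU' hq) _ hf
    · rintro q (hq | hq | ⟨rfl, hq, hf⟩)
      · exact .inl (hB' (.inl hq))
      · exact .inl (hB' (.inr hq))
      · exact .inr ⟨rfl, hB' (.inl hq), hf⟩
  obtain ⟨B', h, hU', hB'⟩ := h
  refine ⟨B', h, hU', ?_⟩
  rintro q (hq | ⟨p, hp, hf⟩)
  · exact hB' (.inl hq)
  · refine hB' (.inr (.inr ?_))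
    simp only [Set.iSup_eq_iUnion, Set.mem_iUnion]
    exact ⟨p.1, p.2, q.1, q.2, rfl, hp, hf⟩

/-- After `(m + 1) ^ 2` passes from a single marked pair, its class is marked. -/
theorem passes_eq (p : Fin (m + 1) × Fin (m + 1)) :
    forAll 2 (forAll 3 pass) m v (memory G {p} ok) = memory G {q | G.ForcesEquiv p q} ok := by
  have hU : ∀ q ∈ {q | G.ForcesEquiv p q}, ∀ r, G.Forces q r → r ∈ {q | G.ForcesEquiv p q} :=
    fun q hq r hf => hq.trans hf.equiv
  let P : ℕ → Memory m → Prop := fun j s =>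
    ∃ B, s = memory G B ok ∧ B ⊆ {q | G.ForcesEquiv p q} ∧ G.reachedIn p j ⊆ B
  have h : P (0 + (m + 1) * ((m + 1) * 1)) (forAll 2 (forAll 3 pass) m v (memory G {p} ok)) := by
    refine forAll_stage (fun x j s hs => forAll_stage (fun y j s hs => ?_) hs)
      ⟨{p}, rfl, ?_, subset_rfl⟩
    · obtain ⟨B, rfl, hB, hj⟩ := hs
      obtain ⟨B', h, hU', hB'⟩ := pass_spec hU hB
      refine ⟨B', h, hU', ?_⟩
      rintro q (hq | ⟨r, hr, hf⟩)
      · exact hB' (.inl (hj hq))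
      · exact hB' (.inr ⟨r, hj hr, hf⟩)
    · rintro q rfl
      exact .refl _
  obtain ⟨B, h, hB, hj⟩ := h
  have := LoopGraph.forcesEquiv_subset_reachedIn G p
  rw [Fintype.card_prod, Fintype.card_fin] at this
  rw [zero_add, mul_one] at hj
  rw [h, hB.antisymm (this.trans hj)]

/-- The answer is written as the negation of the reasons for rejection, which are collected as a
supremum of propositions by `forAll_iSup`. -/
theorem search_spec {rej : Prop} : ∃ B', search m v (memory G B (¬ rej)) =
    memory G B' (¬ (rej ∨ ∃ x y, G.ForcesEquiv (v 0, v 1) (x, y) ∧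
      G.Forces (x, y) (v 1, v 0))) := by
  simp only [search, andThen, clearAll_eq, mark_eq, Set.empty_union, passes_eq]
  let R : Prop → Memory m → Prop := fun a s =>
    s = memory G {q | G.ForcesEquiv (v 0, v 1) q} (¬ a)
  have h : R (rej ⊔ ⨆ x, ⨆ y, (G.ForcesEquiv (v 0, v 1) (x, y) ∧ G.Forces (x, y) (v 1, v 0)))
      (forAll 2 (forAll 3 check) m v (memory G {q | G.ForcesEquiv (v 0, v 1) q} (¬ rej))) := by
    refine forAll_iSup (fun x a s hs => forAll_iSup (fun y a s hs => ?_) hs) rfl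
    rw [hs]
    refine check_eq.trans ?_
    simp only [Function.update_self, Function.update_of_ne, ne_eq, Fin.reduceEq,
      not_false_eq_true]
    rfl
  refine ⟨{q | G.ForcesEquiv (v 0, v 1) q}, h.trans ?_⟩
  simp only [sup_Prop_eq, iSup_Prop_eq]

theorem recognize_spec : ∃ B', recognize m v (memory G B True) =
    memory G B' (G.IsReflexive ∧ ∀ u w, u ≠ w → ¬ G.ForcesEquiv (u, w) (w, u)) := by
  have h1 : (fun a s => s = memory G B (¬ a)) (False ⊔ ⨆ u, ¬ G.Adj u u) (forAll 0
      (visit .adj 0 0 (fun r c => (r.1, r.2 && c)) fun _ c => c) m v (memory G B True)) := by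
    refine forAll_iSup (R := fun a s => s = memory G B (¬ a)) (fun u a s hs => ?_)
      (by rw [not_false_eq_true])
    rw [hs]
    refine loop_eq.trans ?_
    simp only [Function.update_self]
    rfl
  let R : Prop → Memory m → Prop := fun a s => ∃ B, s = memory G B (¬ a)
  have h2 := forAll_iSup (v := v) (k := 0) (f := forAll 1 search) (R := R)
    (Y := fun u => ⨆ w, ∃ x y, G.ForcesEquiv (u, w) (x, y) ∧ G.Forces (x, y) (w, u))
    (fun u a s hs => forAll_iSup (fun w a s hs => by
      obtain ⟨B, rfl⟩ := hs
      have := search_spec (G := G) (B := B) (rej := a)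
        (v := Function.update (Function.update v 0 u) 1 w)
      simp only [Function.update_self, Function.update_of_ne, ne_eq, Fin.reduceEq,
        not_false_eq_true] at this
      exact this) hs) ⟨B, h1⟩
  obtain ⟨B', h⟩ := h2
  refine ⟨B', h.trans ?_⟩
  congr 1
  simp only [sup_Prop_eq, iSup_Prop_eq, false_or, not_or, not_exists, not_not]
  refine propext (and_congr_right fun _ => ⟨fun h u w hne he => ?_, fun h u w x y hxy => ?_⟩)
  -- The search looks for the last step of a chain; there is one since `u ≠ w`.
  · obtain ⟨i, he⟩ := he
    cases he with
    | refl => exact hne rfl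
    | @step q _ _ he hf => exact h u w q.1 q.2 ⟨he.equiv, hf⟩
  · obtain ⟨he, hf⟩ := hxy
    refine h u w ?_ (he.trans hf.equiv)
    -- A pair of equal vertices is not forced by anything.
    rintro rfl
    exact hf.2.2.1 hf.1

end Correctness

end StackProg

/-! ### Reading the input, and leaving only the answer -/

namespace StackProg

/-- Remove all symbols from a stack. -/
def clear {K F : Type} (k : K) : StackProg K (Option Bool × F) := whileFetch k forget

/-- Remove all symbols from the stacks of a list. -/
def clearAll {K F : Type} : List K → StackProg K (Option Bool × F)
  | [] => forget
  | k :: l => (clear k).seq (clearAll l)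

/-- Push a symbol on each stack of a list. -/
def pushAll {K σ : Type} : List K → StackProg K σ
  | [] => load id
  | k :: l => (push k fun _ => true).seq (pushAll l)

section

variable {K F σ : Type} [DecidableEq K]

theorem clear_runs {k : K} {o : Option Bool} {r : F} {S : K → List Bool} :
    Runs (clear k) ((o, r), S) ((none, r), Function.update S k []) (3 * (S k).length + 2) := by
  have key : ∀ (L : List Bool) (S : K → List Bool), S k = L.tail →
      Runs (loop (fun s => s.1.isSome) (forget.seq (fetch k))) ((L.head?, r), S)
        ((none, r), Function.update S k []) (3 * L.length + 1) := by
    intro L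
    induction L with
    | nil =>
      intro S hS
      refine (Exec.loopEnd (a := ((none, r), S)) rfl).runs.congr (by omega) ?_
      rw [← show S k = [] from hS, Function.update_eq_self]
    | cons b L ih =>
      intro S hS
      have h1 : Runs (forget.seq (fetch k)) ((some b, r), S)
          ((L.head?, r), Function.update S k L.tail) 2 := by
        have := (Exec.load (f := fun s : Option Bool × F => (none, s.2)) (s := (some b, r))
          (S := S)).runs.seq (fetch_runs (k := k))
        simpa [hS, forget] using this
      refine (Runs.loopStep rfl h1 (ih _ (by simp))).congr (by simp; omega) ?_
      rw [Function.update_idem]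
  refine (fetch_runs.seq (key (S k) _ (by simp))).congr (by omega) ?_
  rw [Function.update_idem]

theorem clearAll_runs {l : List K} {o : Option Bool} {r : F} {S : K → List Bool} {N : ℕ}
    (hS : ∀ k, (S k).length ≤ N) :
    Runs (clearAll l) ((o, r), S) ((none, r), fun k => if k ∈ l then [] else S k)
      (l.length * (3 * N + 2) + 1) := by
  induction l generalizing o S with
  | nil => exact Exec.load.runs.congr (by simp) (by simp)
  | cons k l ih =>
    have h1 := clear_runs (k := k) (o := o) (r := r) (S := S)
    refine (h1.seq (ih (S := Function.update S k []) fun x => ?_)).congr ?_ ?_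
    · by_cases hx : x = k
      · subst hx; simp
      · simpa [hx] using hS x
    · have := hS k
      rw [List.length_cons, Nat.add_mul l.length, one_mul]
      omega
    · congr 1
      funext x
      by_cases hx : x = k <;> simp [hx]

theorem pushAll_runs {l : List K} (hl : l.Nodup) {s : σ} {S : K → List Bool} :
    Runs (pushAll l) (s, S) (s, fun k => if k ∈ l then true :: S k else S k) (l.length + 1) := by
  induction l generalizing S with
  | nil => exact Exec.load.runs.congr (by simp) (by simp)
  | cons k l ih =>
    rw [List.nodup_cons] at hl
    refine (Exec.push.runs.seq (ih hl.2)).congr (by simp; omega) ?_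
    congr 1
    funext x
    by_cases hx : x = k
    · subst hx; simp [hl.1]
    · simp [hx]

end

/-- The stacks that hold the number of vertices in unary. -/
def unaryStacks : List Stack := .size :: (List.finRange 8).map .todo

theorem nodup_unaryStacks : unaryStacks.Nodup := by
  simp [unaryStacks, List.nodup_finRange, List.nodup_map_iff (f := Stack.todo)
    (fun _ _ h => by simpa using h)]

/-- Split the input, which is on the stack of the adjacency matrix: the unary number is moved to
its stacks, the terminating `0` is removed. -/
def readSize : StackProg Stack (Option Bool × Bool × Bool) :=
  (fetch (.back .adj)).seq <|
    (loop (fun s => s.1 == some true) ((pushAll unaryStacks).seq (fetch (.back .adj)))).seq forget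

/-- Fill the array of marks with `0`. -/
def fillMarks : StackProg Stack (Option Bool × Bool × Bool) :=
  count .size .aux₁ (count (.todo 0) (.done 0) (push (.back .mark) fun _ => false))

/-- Remove everything but the answer, which is left on the output stack, and reset the flags. -/
noncomputable def finish : StackProg Stack (Option Bool × Bool × Bool) :=
  (clearAll Finset.univ.toList).seq <| (push .out fun s => s.2.2).seq <|
    load fun _ => (none, true, true)

/-- The whole program; for the graph without vertices, the search is skipped. -/
noncomputable def main (p : StackProg Stack (Option Bool × Bool × Bool)) :
    StackProg Stack (Option Bool × Bool × Bool) :=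
  readSize.seq <| ((fetch .size).seq <| ite (fun s => s.1.isSome)
    ((push .size fun _ => true).seq <| forget.seq <| fillMarks.seq p) (load id)).seq finish

/-- The stacks after the size `n` has been read, when the rest of the input is `L` and the array of
marks holds `M`. -/
def loaded (n : ℕ) (L M : List Bool) : Stack → List Bool
  | .todo _ => List.replicate n true
  | .size => List.replicate n true
  | .back .adj => L
  | .back .mark => M
  | _ => []

/-- On the code of a graph, `readSize` separates the number of vertices and the matrix. -/
theorem readSize_runs {r : Bool × Bool} (n : ℕ) (L : List Bool) :
    Runs readSize ((none, r), loaded 0 (List.replicate n true ++ false :: L) [])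
      ((none, r), loaded n L []) (n * 12 + 3) := by
  have hfetch : ∀ o j b L, Runs (fetch (.back .adj)) ((o, r), loaded j (b :: L) [])
      ((some b, r), loaded j L []) 1 := by
    intro o j b L
    refine fetch_runs.congr le_rfl ?_
    congr 1
    funext k
    by_cases hk : k = .back .adj
    · subst hk; simp [loaded]
    · rw [Function.update_of_ne hk]
      cases k with
      | back a => cases a <;> simp_all [loaded]
      | _ => rfl
  have key : ∀ d j,
      Runs (loop (fun s => s.1 == some true) ((pushAll unaryStacks).seq (fetch (.back .adj))))
        (((List.replicate d true ++ [false]).head?, r),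
          loaded j (List.replicate d true ++ false :: L).tail [])
        ((some false, r), loaded (j + d) L []) (d * 12 + 1) := by
    intro d
    induction d with
    | zero => exact fun j => (Exec.loopEnd rfl).runs
    | succ d ih =>
      intro j
      have h1 : Runs (pushAll unaryStacks) ((some true, r),
          loaded j (List.replicate d true ++ false :: L) [])
          ((some true, r), loaded (j + 1) (List.replicate d true ++ false :: L) []) 10 := by
        refine (pushAll_runs nodup_unaryStacks).congr (by simp [unaryStacks]) ?_
        congr 1
        funext k
        cases k with
        | back a => cases a <;> simp [unaryStacks, loaded]
        | _ => simp [unaryStacks, loaded, List.replicate_succ]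
      have h2 : Runs (fetch (.back .adj)) ((some true, r),
          loaded (j + 1) (List.replicate d true ++ false :: L) [])
          (((List.replicate d true ++ [false]).head?, r),
            loaded (j + 1) (List.replicate d true ++ false :: L).tail []) 1 := by
        cases d with
        | zero => exact hfetch _ _ _ _
        | succ d => exact hfetch _ _ _ _
      refine (Runs.loopStep rfl (h1.seq h2) (ih (j + 1))).congr (by omega) ?_
      rw [add_assoc, add_comm 1 d]
  have h1 : Runs (fetch (.back .adj)) ((none, r), loaded 0 (List.replicate n true ++ false :: L) [])
      (((List.replicate n true ++ [false]).head?, r),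
        loaded 0 (List.replicate n true ++ false :: L).tail []) 1 := by
    cases n with
    | zero => exact hfetch _ _ _ _
    | succ n => exact hfetch _ _ _ _
  refine (h1.seq ((key n 0).seq Exec.load.runs)).congr (by omega) ?_
  rw [zero_add]

theorem fillMarks_runs {r : Bool × Bool} (n : ℕ) (L : List Bool) :
    Runs fillMarks ((none, r), loaded n L [])
      ((none, r), loaded n L (List.replicate (n * n) false)) (n * (n * 8 + 4 + 7) + 4) := by
  have hmark : ∀ (k : Stack) (l M : List Bool) (S : Stack → List Bool), k ≠ .back .mark →
      Function.update (Function.update S (.back .mark) M) k l =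
        Function.update (Function.update S k l) (.back .mark) M :=
    fun k l M S hk => Function.update_comm (Ne.symm hk) _ _ _
  have hS : ∀ M, loaded n L M = Function.update (loaded n L []) (.back .mark) M := by
    intro M
    funext k
    by_cases hk : k = .back .mark
    · subst hk; simp [loaded]
    · rw [Function.update_of_ne hk]
      cases k with
      | back a => cases a <;> simp_all [loaded]
      | _ => rfl
  have h := count_runs (k := .size) (l := .aux₁) (by simp)
    (p := count (.todo 0) (.done 0) (push (.back .mark) fun _ => false)) (n := n)
    (T := n * 8 + 4) (fun j => (r, loaded n L (List.replicate (j * n) false)))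
    (fun j _ => rfl) (fun j _ => rfl) fun j hj => by
      have h := count_runs (k := .todo 0) (l := .done 0) (by simp)
        (p := push (.back .mark) fun _ : Option Bool × Bool × Bool => false) (n := n) (T := 1)
        (fun i => (r, Function.update (Function.update
          (loaded n L (List.replicate (j * n + i) false)) .size
          (List.replicate (n - 1 - j) true)) .aux₁ (List.replicate j true)))
        (fun i _ => by simp [loaded]) (fun i _ => by simp [loaded]) fun i hi => by
          refine Exec.push.runs.congr le_rfl ?_
          congr 1
          simp only [hS (List.replicate _ false), hmark _ _ _ _ (show Stack.size ≠ _ by simp),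
            hmark _ _ _ _ (show Stack.aux₁ ≠ _ by simp),
            hmark _ _ _ _ (show Stack.todo 0 ≠ _ by simp),
            hmark _ _ _ _ (show Stack.done 0 ≠ _ by simp), Function.update_self,
            Function.update_idem]
          rfl
      rw [Nat.succ_mul]
      exact h
  rw [zero_mul] at h
  exact h

theorem finish_runs {o : Option Bool} {r : Bool × Bool} {S : Stack → List Bool} {N : ℕ}
    (hS : ∀ k, (S k).length ≤ N) :
    Runs finish ((o, r), S) ((none, true, true), Function.update (fun _ => []) .out [r.2])
      (Fintype.card Stack * (3 * N + 2) + 3) := by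
  refine ((clearAll_runs hS).seq (Exec.push.runs.seq Exec.load.runs)).congr ?_ ?_
  · rw [Finset.length_toList, Finset.card_univ]
  · congr 1
    funext k
    by_cases hk : k = .out <;> simp [hk]

/-- A polynomial with coefficients in `ℕ` is monotone. -/
theorem eval_le_eval (T : Polynomial ℕ) {a b : ℕ} (h : a ≤ b) : T.eval a ≤ T.eval b := by
  rw [Polynomial.eval_eq_sum, Polynomial.eval_eq_sum]
  exact Finset.sum_le_sum fun i _ => Nat.mul_le_mul_left _ (Nat.pow_le_pow_left h i)

theorem rowMajor_false (n : ℕ) :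
    rowMajor (fun _ _ : Fin n => false) = List.replicate (n * n) false := by
  simp [rowMajor, List.ofFn_const]

open Classical in
theorem encode_eq {n : ℕ} (G : LoopGraph (Fin n)) :
    FiniteLoopGraph.encode ⟨n, G⟩ =
      List.replicate n true ++ false :: rowMajor fun i j => decide (G.Adj i j) := by
  rw [rowMajor_eq_flatMap]
  rfl

theorem config_memory {m : ℕ} (G : LoopGraph (Fin (m + 1))) (v : Fin 8 → Fin (m + 1)) :
    config 0 v (memory G ∅ True) = ((none, true, true), loaded (m + 1)
      (rowMajor fun i j => (memory G ∅ True).arr .adj i j)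
      (List.replicate ((m + 1) * (m + 1)) false)) := by
  unfold config
  refine Prod.ext (by simp [memory']) ?_
  funext k
  cases k with
  | back a =>
    cases a
    · rfl
    · rw [← rowMajor_false]
      simp [contents, loaded, memory']
  | _ => simp [contents, loaded]

end StackProg

open StackProg in
theorem corollary8 :
    DecidableInPolyTime FiniteLoopGraph.encode
      (fun G : FiniteLoopGraph => G.2.IsStrongCocomparability) := by
  classical
  obtain ⟨p, T, hp⟩ := feasible_recognize
  refine nonempty_computable (main p) (.back .adj) .out (none, true, true) _ _
    (12 * .X + (.X * (.X * 8 + 11)) + T + (Fintype.card Stack * (3 * .X + 2)) + 20) ?_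
  rintro ⟨n, G⟩
  rw [encode_eq]
  have hstart : ∀ L : List Bool, (Function.update (fun _ => []) (.back .adj) L :
      Stack → List Bool) = loaded 0 L [] := by
    intro L
    funext k
    cases k with
    | back a => cases a <;> simp [loaded]
    | _ => simp [loaded]
  rw [hstart]
  set A := rowMajor fun i j => decide (G.Adj i j) with hA
  have hlen : (List.replicate n true ++ false :: A).length = n + n * n + 1 := by
    simp [hA]; omega
  suffices h : ∃ o r S, Runs ((fetch .size).seq (ite (fun s => s.1.isSome)
      ((push .size fun _ => true).seq (forget.seq (fillMarks.seq p))) (load id)))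
      ((none, true, true), loaded n A []) ((o, r), S) (n * (n * 8 + 11) + T.eval n + 8) ∧
      (∀ k, (S k).length ≤ n + n * n + 1) ∧ r.2 = decide G.IsStrongCocomparability by
    obtain ⟨o, r, S, hmid, hS, hr⟩ := h
    obtain ⟨t, ht, h⟩ := (readSize_runs n A).seq (hmid.seq (finish_runs hS))
    rw [hr] at h
    refine ⟨t, ht.trans ?_, h⟩
    rw [hlen]
    simp only [Polynomial.eval_add, Polynomial.eval_mul, Polynomial.eval_X,
      Polynomial.eval_ofNat, Polynomial.eval_natCast, Nat.cast_id]
    have h1 : T.eval n ≤ T.eval (n + n * n + 1) := eval_le_eval T (by omega)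
    have h2 : n * (n * 8 + 11) ≤ (n + n * n + 1) * ((n + n * n + 1) * 8 + 11) :=
      Nat.mul_le_mul (by omega) (by omega)
    omega
  cases n with
  | zero =>
    -- There are no vertices, hence nothing to forbid; a loop variable would have no value.
    refine ⟨none, (true, true), loaded 0 A [],
      (fetch_runs.seq (Exec.iteFalse rfl Exec.load).runs).congr (by omega) ?_, fun k => ?_, ?_⟩
    · exact Prod.ext rfl (Function.update_eq_self _ _)
    · cases k with
      | back a => cases a <;> simp [loaded, hA]
      | _ => simp [loaded]
    · exact (decide_eq_true (LoopGraph.isStrongCocomparability_iff.2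
        ⟨fun v => v.elim0, fun v => v.elim0⟩)).symm
  | succ m =>
    let v : Fin 8 → Fin (m + 1) := fun _ => 0
    obtain ⟨B', hB'⟩ := recognize_spec (G := G) (B := ∅) (v := v)
    have hsearch := hp m v (memory G ∅ True)
    rw [hB', config_memory] at hsearch
    have hfetch : Runs (fetch .size) ((none, true, true), loaded (m + 1) A [])
        ((some true, true, true),
          Function.update (loaded (m + 1) A []) .size (List.replicate m true)) 1 := fetch_runs
    have hback : Function.update (Function.update (loaded (m + 1) A []) .size
        (List.replicate m true)) .size (true :: List.replicate m true) =
        loaded (m + 1) A [] := by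
      rw [Function.update_idem, ← List.replicate_succ]
      exact Function.update_eq_self _ _
    have hpush : Runs (push .size fun _ => true) ((some true, true, true),
        Function.update (loaded (m + 1) A []) .size (List.replicate m true))
        ((some true, true, true), loaded (m + 1) A []) 1 := by
      refine Exec.push.runs.congr le_rfl ?_
      rw [Function.update_self, hback]
    have hforget : Runs forget ((some true, true, true), loaded (m + 1) A [])
        ((none, true, true), loaded (m + 1) A []) 1 := Exec.load.runs
    obtain ⟨t, ht, h⟩ := hpush.seq (hforget.seq ((fillMarks_runs (m + 1) A).seq hsearch))
    refine ⟨_, _, _, (hfetch.seq (Exec.iteTrue rfl h).runs).mono ?_, fun k => ?_, ?_⟩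
    · have : T.eval m ≤ T.eval (m + 1) := eval_le_eval T (by omega)
      rw [show (m + 1) * 8 + 4 + 7 = (m + 1) * 8 + 11 by omega] at ht
      omega
    · cases k <;> simp [contents] <;> omega
    · exact decide_eq_decide.2 LoopGraph.isStrongCocomparability_iff.symm
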